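/- Let $\Bbbk$ be a field of characteristic $\neq 2$. Let $\mathsf{SAlgf}_\Bbbk$ be the category of finite-dimensional supercommutative $\Bbbk$-superalgebras ($\mathbb{Z}_2$-graded $\Bbbk$-algebras with central even part, in which odd elements have square zero) and graded algebra homomorphisms. A *formal superscheme* is a functor $\mathfrak X:\mathsf{SAlgf}_\Bbbk\to\mathsf{Sets}$ isomorphic to the inductive limit of a filtered inductive system of functors $\mathrm{SSpf}\,A_\lambda=\mathrm{Hom}(A_\lambda,-)$, with $A_\lambda\in\mathsf{SAlgf}_\Bbbk$, whose transition maps are induced by surjective homomorphisms $A_\mu\to A_\lambda$; a map of formal superschemes is a natural transformation. For a formal superscheme $\mathfrak X$, let $\mathcal O_*(\mathfrak X)=\varinjlim_{(R,a),\,a\in\mathfrak X(R)}R^*$ be its super-cocommutative super-coalgebra (so $\mathcal O_*(\mathrm{SSpf}\,A)=A^*$, and $\mathcal O_*(\varinjlim \mathrm{SSpf}\,A_\lambda)=\varinjlim A_\lambda^*$), let $|\mathfrak X|=\varinjlim_{(R,a)}\mathrm{SSpec}\,R$ be its set of points, and for $x\in|\mathfrak X|$ let $\mathfrak X_x\subseteq\mathfrak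 X$ be its irreducible component at $x$: $\mathfrak X_x(R)$ consists of those $a\in\mathfrak X(R)$ for which the map $\mathrm{SSpec}\,R\to|\mathfrak X|$ defined by $a$ takes no value other than $x$. A map $\mathbf f:\mathfrak X\to\mathfrak Y$ induces a super-coalgebra map $\mathcal O_*(\mathbf f):\mathcal O_*(\mathfrak X)\to\mathcal O_*(\mathfrak Y)$, a map $|\mathbf f|:|\mathfrak X|\to|\mathfrak Y|$, and maps $\mathfrak X_x\to\mathfrak Y_{\mathbf f(x)}$. A map $\mathbf f$ is *flat* if the functor $\mathbf f^*=-\,\square_{\mathcal O_*(\mathfrak Y)}\,\mathcal O_*(\mathfrak X)$ (cotensor product) on right super-comodules over $\mathcal O_*(\mathfrak Y)$ and even comodule maps preserves exact sequences, and *faithfully flat* if $\mathbf f^*$ is faithfully exact, i.e. a sequence is exact if and only if its image under $\mathbf f^*$ is exact. It is *flat at* $x\in|\mathfrak X|$ if the induced map $\mathfrak X_x\to\mathfrak Y_{\mathbf f(x)}$ is flat. It is *surjective* if $|\mathbf f|$ is surjective, and *strictly surjective* if $\mathcal O_*(\mathbf f)$ is surjective. **Proposition.** Let $\mathbf f:\mathfrak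 X\to\mathfrak Y$ be a map of formal superschemes. 1. $\mathbf f$ is flat if and only if it is flat at every $x\in|\mathfrak X|$. 2. The following conditions are equivalent: (a) $\mathbf f$ is faithfully flat; (b) $\mathbf f$ is flat and surjective; (c) $\mathbf f$ is flat and strictly surjective. -/

import Mathlib

open CategoryTheory TensorProduct

universe u w

noncomputable section

namespace FormalSuper

/-! ### Finite-dimensional supercommutative superalgebras -/

/-- A finite-dimensional supercommutative superalgebra over the field `k`: a `ℤ/2`-graded
`k`-algebra whose even part is central and whose odd elements have square zero. -/
structure SAlgf (k : Type u) [Field k] where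
  carrier : Type u
  [ring : Ring carrier]
  [algebra : Algebra k carrier]
  grading : ZMod 2 → Submodule k carrier
  [graded : GradedAlgebra grading]
  [finite : Module.Finite k carrier]
  even_central : ∀ a ∈ grading 0, ∀ b : carrier, a * b = b * a
  odd_sq : ∀ a ∈ grading 1, a * a = 0

attribute [instance] SAlgf.ring SAlgf.algebra SAlgf.graded SAlgf.finite

/-- The category of finite-dimensional supercommutative superalgebras; morphisms are the
`k`-algebra homomorphisms that preserve the grading. -/
instance (k : Type u) [Field k] : Category.{u} (SAlgf k) where
  Hom A B := A.grading →ₐᵍ[k] B.grading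
  id A := GradedAlgHom.id k A.grading
  comp f g := GradedAlgHom.comp g f

variable {k : Type u} [Field k]

/-- The graded algebra homomorphism underlying a morphism of `SAlgf k`. -/
def SAlgf.Hom.gr {A B : SAlgf k} (h : A ⟶ B) : A.grading →ₐᵍ[k] B.grading := h

/-- The linear map underlying a morphism of `SAlgf k`. -/
def SAlgf.Hom.lin {A B : SAlgf k} (h : A ⟶ B) : A.carrier →ₗ[k] B.carrier :=
  (SAlgf.Hom.gr h).toAlgHom.toLinearMap

/-! ### Formal superschemes -/

/-- `SSpf A` is the formal super functor `R ↦ Hom(A, R)`; this is the (contravariant) functor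
`A ↦ SSpf A`. -/
abbrev SSpf : (SAlgf k)ᵒᵖ ⥤ (SAlgf k ⥤ Type u) := coyoneda

/-- A formal super functor `X` is a formal superscheme if it is the inductive limit of a filtered
inductive system of finite affine superschemes `SSpf (A j)` whose transition morphisms are closed
immersions, i.e. are induced by surjective homomorphisms of superalgebras. -/
def IsFormalSuperscheme (X : SAlgf k ⥤ Type u) : Prop :=
  ∃ (J : Type u) (_ : SmallCategory J) (_ : IsFiltered J) (D : J ⥤ (SAlgf k)ᵒᵖ)
    (_ : ∀ {i j : J} (t : i ⟶ j), Function.Surjective (SAlgf.Hom.lin (D.map t).unop))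
    (c : Limits.Cocone (D ⋙ SSpf)) (_ : Limits.IsColimit c), Nonempty (X ≅ c.pt)

/-! ### The set of points of a formal superscheme -/

/-- The prime superideals of a superalgebra, i.e. the points of `SSpec R`. -/
def SSpec (R : SAlgf k) : Type u :=
  {p : Ideal R.carrier // p.IsPrime ∧ p.IsHomogeneous R.grading}

/-- The map `SSpec S → SSpec R`, `p ↦ h⁻¹(p)`, induced by a homomorphism `h : R → S`. -/
def SSpec.comap {R S : SAlgf k} (h : R ⟶ S) (p : SSpec S) : SSpec R :=
  ⟨p.1.comap (SAlgf.Hom.gr h).toAlgHom.toRingHom, by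
    have := p.2.1
    exact Ideal.comap_isPrime _ _, by
    intro i x hx
    have hx' : (SAlgf.Hom.gr h) x ∈ p.1 := hx
    have := p.2.2 i hx'
    change (SAlgf.Hom.gr h) _ ∈ p.1
    rwa [← map_directSumDecompose] at this⟩

/-- The pairs `(R, a)` with `a ∈ X(R)`. -/
structure Pair (X : SAlgf k ⥤ Type u) : Type (u + 1) where
  alg : SAlgf k
  elt : X.obj alg

/-- A morphism of pairs `(R, a) → (S, b)`: a homomorphism `h : R → S` with `X(h)(a) = b`. -/
structure Pair.Hom {X : SAlgf k ⥤ Type u} (a b : Pair X) : Type u where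
  hom : a.alg ⟶ b.alg
  map_elt : X.map hom a.elt = b.elt

/-- The pair `(R, f(a))` over `Y` obtained from a pair `(R, a)` over `X` by means of
`f : X → Y`. -/
abbrev Pair.map {X Y : SAlgf k ⥤ Type u} (f : X ⟶ Y) (a : Pair X) : Pair Y :=
  ⟨a.alg, f.app a.alg a.elt⟩

/-- The action of `f : X → Y` on morphisms of pairs. -/
abbrev Pair.Hom.map {X Y : SAlgf k ⥤ Type u} (f : X ⟶ Y) {a b : Pair X} (h : a.Hom b) :
    (a.map f).Hom (b.map f) :=
  ⟨h.hom, by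
    have e := NatTrans.naturality_apply f h.hom a.elt
    rw [h.map_elt] at e
    exact e.symm⟩

/-- The points of the geometric realization `|X|`, that is, of the inductive limit of the spaces
`SSpec R` over the category of pairs `(R, a)` with `a ∈ X(R)`. (It is a discrete space if `X` is a
formal superscheme; only its points are used.) -/
def Points (X : SAlgf k ⥤ Type u) : Type (u + 1) :=
  Quot (fun s t : (Σ a : Pair X, SSpec a.alg) =>
    ∃ h : s.1.Hom t.1, s.2 = SSpec.comap h.hom t.2)

/-- The point of `|X|` defined by `a ∈ X(R)` and `p ∈ SSpec R`. -/
def Points.mk {X : SAlgf k ⥤ Type u} {R : SAlgf k} (a : X.obj R) (p : SSpec R) : Points X :=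
  Quot.mk _ ⟨⟨R, a⟩, p⟩

theorem Points.mk_map {X : SAlgf k ⥤ Type u} {R S : SAlgf k} (h : R ⟶ S) (a : X.obj R)
    (p : SSpec S) : Points.mk (X.map h a) p = Points.mk a (SSpec.comap h p) :=
  (Quot.sound ⟨⟨h, rfl⟩, rfl⟩).symm

/-- The map `|f| : |X| → |Y|`. -/
def Points.map {X Y : SAlgf k ⥤ Type u} (f : X ⟶ Y) : Points X → Points Y :=
  Quot.map (fun s => ⟨s.1.map f, s.2⟩) (fun _ _ ⟨h, e⟩ => ⟨h.map f, e⟩)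

/-- The irreducible component `X_x` of `X` at the point `x`: the subfunctor of those `a ∈ X(R)`
for which the map `SSpec R → |X|` defined by `a` takes no value other than `x`. -/
def component (X : SAlgf k ⥤ Type u) (x : Points X) : Subfunctor X where
  obj R := {a | ∀ p : SSpec R, Points.mk a p = x}
  map h a ha p := by rw [Points.mk_map]; exact ha _

/-- The map `X_x → Y_y` induced by `f : X → Y`, where `y = f(x)`. -/
def componentMap {X Y : SAlgf k ⥤ Type u} (f : X ⟶ Y) (x : Points X) :
    (component X x).toFunctor ⟶ (component Y (Points.map f x)).toFunctor :=
  Subfunctor.lift ((component X x).ι ≫ f) (by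
    rintro R _ ⟨a, rfl⟩ p
    exact congrArg (Points.map f) (a.2 p))

/-! ### The dual super-coalgebra of a finite-dimensional superalgebra -/

/-- The opposite multiplication `a ⊗ b ↦ b a`. In a supercommutative superalgebra this is
`(-1)^{|a||b|} a b`. -/
def mulOp (R : SAlgf k) : R.carrier ⊗[k] R.carrier →ₗ[k] R.carrier :=
  LinearMap.mul' k R.carrier ∘ₗ (TensorProduct.comm k R.carrier R.carrier).toLinearMap

/-- The coproduct of `R^*` is the transpose of the multiplication of `R` with respect to the pairing
`⟨f ⊗ g, a ⊗ b⟩ = (-1)^{|g||a|} f(a) g(b)` prescribed by the sign rule, that is, `Δ f = ∑ f₁ ⊗ f₂`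
where `∑ f₁(a) f₂(b) = f (b a)`; the counit is `f ↦ f(1)`. -/
instance dualCoalgebraStruct (R : SAlgf k) : CoalgebraStruct k (Module.Dual k R.carrier) where
  comul := (TensorProduct.dualDistribEquiv k R.carrier R.carrier).symm.toLinearMap ∘ₗ
    (mulOp R).dualMap
  counit := LinearMap.applyₗ (1 : R.carrier)

theorem dual_comul_apply (R : SAlgf k) (f : Module.Dual k R.carrier) (a b : R.carrier) :
    TensorProduct.dualDistrib k R.carrier R.carrier (Coalgebra.comul (R := k) f) (a ⊗ₜ b)
      = f (b * a) := by
  have h := (TensorProduct.dualDistribEquiv k R.carrier R.carrier).apply_symm_apply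
    ((mulOp R).dualMap f)
  exact LinearMap.congr_fun h (a ⊗ₜ b)

theorem dualDistrib_injective (V W : Type u) [AddCommGroup V] [AddCommGroup W] [Module k V]
    [Module k W] [Module.Finite k V] [Module.Finite k W] :
    Function.Injective (TensorProduct.dualDistrib k V W) :=
  (TensorProduct.dualDistribEquiv k V W).injective

theorem dual_counit_apply (R : SAlgf k) (f : Module.Dual k R.carrier) :
    Coalgebra.counit (R := k) f = f 1 := rfl

theorem dual_rTensor_counit (R : SAlgf k)
    (x : Module.Dual k R.carrier ⊗[k] Module.Dual k R.carrier) (a : R.carrier) :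
    TensorProduct.lid k _ ((Coalgebra.counit (R := k) (A := Module.Dual k R.carrier)).rTensor _ x) a
      = TensorProduct.dualDistrib k R.carrier R.carrier x (1 ⊗ₜ a) := by
  induction x using TensorProduct.induction_on with
  | zero => simp
  | tmul f g => simp [dual_counit_apply]
  | add x y hx hy => simp only [map_add, LinearMap.add_apply, hx, hy]

theorem dual_lTensor_counit (R : SAlgf k)
    (x : Module.Dual k R.carrier ⊗[k] Module.Dual k R.carrier) (a : R.carrier) :
    TensorProduct.rid k _ ((Coalgebra.counit (R := k) (A := Module.Dual k R.carrier)).lTensor _ x) a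
      = TensorProduct.dualDistrib k R.carrier R.carrier x (a ⊗ₜ 1) := by
  induction x using TensorProduct.induction_on with
  | zero => simp
  | tmul f g => simp [dual_counit_apply, mul_comm]
  | add x y hx hy => simp only [map_add, LinearMap.add_apply, hx, hy]

/-- The canonical map `R^* ⊗ (R^* ⊗ R^*) → (R ⊗ (R ⊗ R))^*`. -/
def dualDistrib₃ (R : SAlgf k) :
    Module.Dual k R.carrier ⊗[k] (Module.Dual k R.carrier ⊗[k] Module.Dual k R.carrier) →ₗ[k]
      Module.Dual k (R.carrier ⊗[k] (R.carrier ⊗[k] R.carrier)) :=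
  TensorProduct.dualDistrib k R.carrier (R.carrier ⊗[k] R.carrier) ∘ₗ
    (TensorProduct.dualDistrib k R.carrier R.carrier).lTensor _

theorem dualDistrib₃_injective (R : SAlgf k) : Function.Injective (dualDistrib₃ R) :=
  (dualDistrib_injective R.carrier (R.carrier ⊗[k] R.carrier)).comp
    (Module.Flat.lTensor_preserves_injective_linearMap _
      (dualDistrib_injective R.carrier R.carrier))

theorem dualDistrib₃_assoc (R : SAlgf k)
    (x : Module.Dual k R.carrier ⊗[k] Module.Dual k R.carrier) (g : Module.Dual k R.carrier)
    (a b c : R.carrier) :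
    dualDistrib₃ R (TensorProduct.assoc k _ _ _ (x ⊗ₜ g)) (a ⊗ₜ (b ⊗ₜ c))
      = TensorProduct.dualDistrib k R.carrier R.carrier x (a ⊗ₜ b) * g c := by
  induction x using TensorProduct.induction_on with
  | zero => simp
  | tmul f h => simp [dualDistrib₃, mul_assoc]
  | add x y hx hy => simp only [TensorProduct.add_tmul, map_add, LinearMap.add_apply, hx, hy, add_mul]

theorem dualDistrib₃_rTensor_comul (R : SAlgf k)
    (x : Module.Dual k R.carrier ⊗[k] Module.Dual k R.carrier) (a b c : R.carrier) :
    dualDistrib₃ R (TensorProduct.assoc k _ _ _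
        ((Coalgebra.comul (R := k) (A := Module.Dual k R.carrier)).rTensor _ x)) (a ⊗ₜ (b ⊗ₜ c))
      = TensorProduct.dualDistrib k R.carrier R.carrier x ((b * a) ⊗ₜ c) := by
  induction x using TensorProduct.induction_on with
  | zero => simp
  | tmul f g =>
    rw [LinearMap.rTensor_tmul, dualDistrib₃_assoc, dual_comul_apply]
    simp
  | add x y hx hy => simp only [map_add, LinearMap.add_apply, hx, hy]

theorem dualDistrib₃_lTensor_comul (R : SAlgf k)
    (x : Module.Dual k R.carrier ⊗[k] Module.Dual k R.carrier) (a b c : R.carrier) :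
    dualDistrib₃ R ((Coalgebra.comul (R := k) (A := Module.Dual k R.carrier)).lTensor _ x)
        (a ⊗ₜ (b ⊗ₜ c))
      = TensorProduct.dualDistrib k R.carrier R.carrier x (a ⊗ₜ (c * b)) := by
  induction x using TensorProduct.induction_on with
  | zero => simp
  | tmul f g =>
    rw [LinearMap.lTensor_tmul, dualDistrib₃, LinearMap.comp_apply, LinearMap.lTensor_tmul,
      TensorProduct.dualDistrib_apply, dual_comul_apply, TensorProduct.dualDistrib_apply]
  | add x y hx hy => simp only [map_add, LinearMap.add_apply, hx, hy]

/-- The super-coalgebra `R^*` dual to a finite-dimensional superalgebra `R`. -/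
instance dualCoalgebra (R : SAlgf k) : Coalgebra k (Module.Dual k R.carrier) where
  coassoc := by
    ext f : 1
    apply dualDistrib₃_injective R
    apply TensorProduct.ext_threefold'
    intro a b c
    simp only [LinearMap.comp_apply, LinearEquiv.coe_coe]
    rw [dualDistrib₃_rTensor_comul, dualDistrib₃_lTensor_comul, dual_comul_apply, dual_comul_apply,
      mul_assoc]
  rTensor_counit_comp_comul := by
    ext f : 1
    apply (TensorProduct.lid k (Module.Dual k R.carrier)).injective
    ext a
    rw [LinearMap.comp_apply, dual_rTensor_counit, dual_comul_apply]
    simp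
  lTensor_counit_comp_comul := by
    ext f : 1
    apply (TensorProduct.rid k (Module.Dual k R.carrier)).injective
    ext a
    rw [LinearMap.comp_apply, dual_lTensor_counit, dual_comul_apply]
    simp

theorem dualDistrib_map {R S : SAlgf k} (l : R.carrier →ₗ[k] S.carrier)
    (x : Module.Dual k S.carrier ⊗[k] Module.Dual k S.carrier) (a b : R.carrier) :
    TensorProduct.dualDistrib k R.carrier R.carrier (TensorProduct.map l.dualMap l.dualMap x)
      (a ⊗ₜ b) = TensorProduct.dualDistrib k S.carrier S.carrier x (l a ⊗ₜ l b) := by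
  induction x using TensorProduct.induction_on with
  | zero => simp
  | tmul f g => simp
  | add x y hx hy => simp only [map_add, LinearMap.add_apply, hx, hy]

/-- The transpose of a homomorphism of superalgebras is a homomorphism of super-coalgebras. -/
def dualMap {R S : SAlgf k} (h : R ⟶ S) :
    Module.Dual k S.carrier →ₗc[k] Module.Dual k R.carrier where
  toLinearMap := (SAlgf.Hom.lin h).dualMap
  counit_comp := by
    ext g
    exact congrArg g (map_one (SAlgf.Hom.gr h).toAlgHom)
  map_comp_comul := by
    ext g : 1
    apply dualDistrib_injective R.carrier R.carrier
    apply TensorProduct.ext'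
    intro a b
    rw [LinearMap.comp_apply, LinearMap.comp_apply, dualDistrib_map, dual_comul_apply,
      dual_comul_apply]
    exact congrArg g (map_mul (SAlgf.Hom.gr h).toAlgHom b a).symm

/-! ### The super-coalgebra of a formal superscheme -/

/-- The direct sum of the super-coalgebras `R^*` over all pairs `(R, a)` with `a ∈ X(R)`. -/
def PreOStar (X : SAlgf k ⥤ Type u) : Type (u + 1) :=
  Π₀ a : Pair X, Module.Dual k a.alg.carrier

instance (X : SAlgf k ⥤ Type u) : AddCommGroup (PreOStar X) :=
  inferInstanceAs (AddCommGroup (Π₀ a : Pair X, Module.Dual k a.alg.carrier))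

instance (X : SAlgf k ⥤ Type u) : Module k (PreOStar X) :=
  inferInstanceAs (Module k (Π₀ a : Pair X, Module.Dual k a.alg.carrier))

open scoped Classical in
instance (X : SAlgf k ⥤ Type u) : Coalgebra k (PreOStar X) :=
  DFinsupp.instCoalgebra k (Pair X) (fun a => Module.Dual k a.alg.carrier)

open scoped Classical in
/-- The inclusion of the summand `R^*` belonging to `(R, a)`. -/
def PreOStar.of {X : SAlgf k ⥤ Type u} (a : Pair X) :
    Module.Dual k a.alg.carrier →ₗ[k] PreOStar X :=
  DFinsupp.lsingle (R := k) (M := fun a : Pair X => Module.Dual k a.alg.carrier) a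

open scoped Classical in
theorem PreOStar.comul_of {X : SAlgf k ⥤ Type u} (a : Pair X)
    (g : Module.Dual k a.alg.carrier) : Coalgebra.comul (R := k) (PreOStar.of a g)
      = TensorProduct.map (PreOStar.of a) (PreOStar.of a) (Coalgebra.comul (R := k) g) :=
  DFinsupp.comul_single k (Pair X) (fun a => Module.Dual k a.alg.carrier) a g

open scoped Classical in
theorem PreOStar.counit_of {X : SAlgf k ⥤ Type u} (a : Pair X)
    (g : Module.Dual k a.alg.carrier) :
    Coalgebra.counit (R := k) (PreOStar.of a g) = Coalgebra.counit (R := k) g :=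
  DFinsupp.counit_single k (Pair X) (fun a => Module.Dual k a.alg.carrier) a g

open scoped Classical in
/-- The linear map out of the direct sum with given components. -/
def PreOStar.lift {X : SAlgf k ⥤ Type u} {V : Type w} [AddCommGroup V] [Module k V]
    (F : ∀ a : Pair X, Module.Dual k a.alg.carrier →ₗ[k] V) : PreOStar X →ₗ[k] V :=
  DFinsupp.lsum (M := fun a : Pair X => Module.Dual k a.alg.carrier) k F

open scoped Classical in
theorem PreOStar.lift_of {X : SAlgf k ⥤ Type u} {V : Type w} [AddCommGroup V] [Module k V]
    (F : ∀ a : Pair X, Module.Dual k a.alg.carrier →ₗ[k] V) (a : Pair X)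
    (g : Module.Dual k a.alg.carrier) : PreOStar.lift F (PreOStar.of a g) = F a g :=
  DFinsupp.lsum_single (M := fun a : Pair X => Module.Dual k a.alg.carrier) k F a g

open scoped Classical in
theorem PreOStar.hom_ext {X : SAlgf k ⥤ Type u} {V : Type w} [AddCommGroup V] [Module k V]
    {F G : PreOStar X →ₗ[k] V} (h : ∀ a, F ∘ₗ PreOStar.of a = G ∘ₗ PreOStar.of a) : F = G :=
  DFinsupp.lhom_ext' (M := fun a : Pair X => Module.Dual k a.alg.carrier) h

/-- The relations `(S, X(h)(a), g) ∼ (R, a, g ∘ h)` for `h : R → S`, `a ∈ X(R)`, `g ∈ S^*`. -/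
def relations (X : SAlgf k ⥤ Type u) : Submodule k (PreOStar X) :=
  Submodule.span k {z | ∃ (a b : Pair X) (h : a.Hom b) (g : Module.Dual k b.alg.carrier),
    z = PreOStar.of b g - PreOStar.of a (dualMap h.hom g)}

theorem relations_mkQ {X : SAlgf k ⥤ Type u} {a b : Pair X} (h : a.Hom b) :
    (relations X).mkQ ∘ₗ PreOStar.of b
      = ((relations X).mkQ ∘ₗ PreOStar.of a) ∘ₗ (dualMap h.hom).toLinearMap := by
  ext g : 1
  exact (Submodule.Quotient.eq _).2 (Submodule.subset_span ⟨a, b, h, g, rfl⟩)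

instance relations_isCoideal (X : SAlgf k ⥤ Type u) : (relations X).IsCoideal where
  counit_eq_zero := by
    change relations X ≤ LinearMap.ker (Coalgebra.counit (R := k) (A := PreOStar X))
    refine Submodule.span_le.2 ?_
    rintro _ ⟨a, b, h, g, rfl⟩
    have e := LinearMap.congr_fun (dualMap h.hom).counit_comp g
    simp only [SetLike.mem_coe, LinearMap.mem_ker, map_sub, sub_eq_zero, PreOStar.counit_of]
    exact e.symm
  map_mkQ_comul_eq_zero := by
    change relations X ≤ LinearMap.ker
      (TensorProduct.map (relations X).mkQ (relations X).mkQ ∘ₗ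
        Coalgebra.comul (R := k) (A := PreOStar X))
    refine Submodule.span_le.2 ?_
    rintro _ ⟨a, b, h, g, rfl⟩
    have e := LinearMap.congr_fun (dualMap h.hom).map_comp_comul g
    simp only [SetLike.mem_coe, LinearMap.mem_ker, map_sub, sub_eq_zero, LinearMap.comp_apply,
      PreOStar.comul_of]
    rw [TensorProduct.map_map, TensorProduct.map_map, relations_mkQ h, ← TensorProduct.map_map]
    exact congrArg _ e

/-- The super-coalgebra `O_*(X)` of a formal superscheme `X`: the inductive limit of the
super-coalgebras `R^*` over all pairs `(R, a)` with `a ∈ X(R)`, the transition maps being the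
transposes of the homomorphisms of superalgebras. This is the left Kan extension of
`SSpf A ↦ A^*`: one has `O_*(SSpf A) = A^*`, and `O_*` carries a filtered inductive limit of
finite affine superschemes `SSpf (A j)` to the inductive limit of the super-coalgebras `(A j)^*`,
so that `O_*` is the quasi-inverse of the equivalence `A ↦ Sp^* A` from super-cocommutative
super-coalgebras to formal superschemes. -/
def OStar (X : SAlgf k ⥤ Type u) : Type (u + 1) := PreOStar X ⧸ relations X

instance (X : SAlgf k ⥤ Type u) : AddCommGroup (OStar X) :=
  inferInstanceAs (AddCommGroup (PreOStar X ⧸ relations X))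

instance (X : SAlgf k ⥤ Type u) : Module k (OStar X) :=
  inferInstanceAs (Module k (PreOStar X ⧸ relations X))

instance (X : SAlgf k ⥤ Type u) : Coalgebra k (OStar X) :=
  inferInstanceAs (Coalgebra k (PreOStar X ⧸ relations X))

/-- The canonical map `R^* → O_*(X)` belonging to a pair `(R, a)` with `a ∈ X(R)`. -/
def OStar.of {X : SAlgf k ⥤ Type u} (a : Pair X) :
    Module.Dual k a.alg.carrier →ₗ[k] OStar X :=
  (relations X).mkQ ∘ₗ PreOStar.of a

theorem OStar.of_comp_dualMap {X : SAlgf k ⥤ Type u} {a b : Pair X} (h : a.Hom b) :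
    OStar.of a ∘ₗ (dualMap h.hom).toLinearMap = OStar.of b := (relations_mkQ h).symm

theorem OStar.comul_of {X : SAlgf k ⥤ Type u} (a : Pair X)
    (g : Module.Dual k a.alg.carrier) : Coalgebra.comul (R := k) (OStar.of a g)
      = TensorProduct.map (OStar.of a) (OStar.of a) (Coalgebra.comul (R := k) g) := by
  have h : Coalgebra.comul (R := k) (OStar.of a g) = TensorProduct.map (relations X).mkQ
      (relations X).mkQ (Coalgebra.comul (R := k) (PreOStar.of a g)) := rfl
  rw [h, PreOStar.comul_of, TensorProduct.map_map]
  rfl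

theorem OStar.counit_of {X : SAlgf k ⥤ Type u} (a : Pair X)
    (g : Module.Dual k a.alg.carrier) :
    Coalgebra.counit (R := k) (OStar.of a g) = Coalgebra.counit (R := k) g :=
  PreOStar.counit_of a g

theorem OStar.hom_ext {X : SAlgf k ⥤ Type u} {V : Type w} [AddCommGroup V] [Module k V]
    {F G : OStar X →ₗ[k] V} (h : ∀ a, F ∘ₗ OStar.of a = G ∘ₗ OStar.of a) : F = G :=
  Submodule.linearMap_qext _ (PreOStar.hom_ext h)

/-- The linear map out of `O_*(X)` defined by a compatible family of linear maps `R^* → V`. -/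
def OStar.lift {X : SAlgf k ⥤ Type u} {V : Type w} [AddCommGroup V] [Module k V]
    (F : ∀ a : Pair X, Module.Dual k a.alg.carrier →ₗ[k] V)
    (hF : ∀ {a b : Pair X} (h : a.Hom b), F a ∘ₗ (dualMap h.hom).toLinearMap = F b) :
    OStar X →ₗ[k] V :=
  (relations X).liftQ (PreOStar.lift F) (Submodule.span_le.2 (by
    rintro _ ⟨a, b, h, g, rfl⟩
    simp only [SetLike.mem_coe, LinearMap.mem_ker, map_sub, sub_eq_zero, PreOStar.lift_of]
    exact (LinearMap.congr_fun (hF h) g).symm))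

theorem OStar.lift_of {X : SAlgf k ⥤ Type u} {V : Type w} [AddCommGroup V] [Module k V]
    (F : ∀ a : Pair X, Module.Dual k a.alg.carrier →ₗ[k] V)
    (hF : ∀ {a b : Pair X} (h : a.Hom b), F a ∘ₗ (dualMap h.hom).toLinearMap = F b)
    (a : Pair X) (g : Module.Dual k a.alg.carrier) :
    OStar.lift F hF (OStar.of a g) = F a g :=
  PreOStar.lift_of F a g

/-- The parity of `O_*(X)`: the component of degree `i` is spanned by the images of the elements of
degree `i` of the super vector spaces `R^*`, that is, of the linear forms on `R` that vanish on the
component of `R` of degree `i + 1`. -/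
def OStar.grading (X : SAlgf k ⥤ Type u) (i : ZMod 2) : Submodule k (OStar X) :=
  ⨆ a : Pair X, (a.alg.grading (i + 1)).dualAnnihilator.map (OStar.of a)

/-- The linear map `O_*(X) → O_*(Y)` given by the identity maps from the term `R^*` belonging to
`(R, a)` to the term `R^*` belonging to `(R, f(a))`. -/
def OStar.mapLin {X Y : SAlgf k ⥤ Type u} (f : X ⟶ Y) : OStar X →ₗ[k] OStar Y :=
  OStar.lift (fun a => OStar.of (a.map f)) (fun h => OStar.of_comp_dualMap (h.map f))

theorem OStar.mapLin_of {X Y : SAlgf k ⥤ Type u} (f : X ⟶ Y) (a : Pair X)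
    (g : Module.Dual k a.alg.carrier) : OStar.mapLin f (OStar.of a g) = OStar.of (a.map f) g :=
  OStar.lift_of (fun a => OStar.of (a.map f)) (fun h => OStar.of_comp_dualMap (h.map f)) a g

/-- The homomorphism of super-coalgebras `O_*(f) : O_*(X) → O_*(Y)`. -/
def OStar.map {X Y : SAlgf k ⥤ Type u} (f : X ⟶ Y) : OStar X →ₗc[k] OStar Y where
  toLinearMap := OStar.mapLin f
  counit_comp := by
    refine OStar.hom_ext fun a => LinearMap.ext fun g => ?_
    simp only [LinearMap.comp_apply, OStar.mapLin_of, OStar.counit_of]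
  map_comp_comul := by
    refine OStar.hom_ext fun a => LinearMap.ext fun g => ?_
    simp only [LinearMap.comp_apply, OStar.mapLin_of, OStar.comul_of]
    rw [TensorProduct.map_map]
    have e : OStar.mapLin f ∘ₗ OStar.of a = OStar.of (a.map f) :=
      LinearMap.ext fun g => OStar.mapLin_of f a g
    rw [e]

/-! ### Super-comodules and the cotensor product -/

/-- A right super-comodule over a super-coalgebra `C` with parity `𝒞`: a super vector space `M`
with a coassociative and counital even map `M → M ⊗ C`. -/
structure SuperComodule {C : Type w} [AddCommGroup C] [Module k C] [Coalgebra k C]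
    (𝒞 : ZMod 2 → Submodule k C) where
  carrier : Type w
  [addCommGroup : AddCommGroup carrier]
  [module : Module k carrier]
  grading : ZMod 2 → Submodule k carrier
  isInternal : DirectSum.IsInternal grading
  coact : carrier →ₗ[k] carrier ⊗[k] C
  coassoc : (TensorProduct.assoc k carrier C C).toLinearMap ∘ₗ coact.rTensor C ∘ₗ coact
    = (Coalgebra.comul (R := k) (A := C)).lTensor carrier ∘ₗ coact
  counit_coact : (Coalgebra.counit (R := k) (A := C)).lTensor carrier ∘ₗ coact
    = (TensorProduct.mk k carrier k).flip 1
  coact_even : ∀ i, ∀ m ∈ grading i,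
    coact m ∈ ⨆ j : ZMod 2, Submodule.map₂ (TensorProduct.mk k carrier C) (grading j) (𝒞 (i - j))

attribute [instance] SuperComodule.addCommGroup SuperComodule.module

/-- A morphism of super-comodules: an even linear map compatible with the coactions. -/
structure SuperComodule.Hom {C : Type w} [AddCommGroup C] [Module k C] [Coalgebra k C]
    {𝒞 : ZMod 2 → Submodule k C} (M N : SuperComodule 𝒞) where
  toLin : M.carrier →ₗ[k] N.carrier
  even : ∀ i, ∀ m ∈ M.grading i, toLin m ∈ N.grading i
  coact_comp : N.coact ∘ₗ toLin = toLin.rTensor C ∘ₗ M.coact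

section Cotensor

variable {C D : Type w} [AddCommGroup C] [Module k C] [Coalgebra k C] [AddCommGroup D] [Module k D]
  [Coalgebra k D] {𝒟 : ZMod 2 → Submodule k D}

/-- The left coaction `C → D ⊗ C` obtained from a homomorphism of coalgebras `φ : C → D`. -/
def leftCoact (φ : C →ₗc[k] D) : C →ₗ[k] D ⊗[k] C :=
  φ.toLinearMap.rTensor C ∘ₗ Coalgebra.comul

/-- The cotensor product `M □_D C` of a right `D`-super-comodule `M` with `C`, where `C` is a left
`D`-super-comodule by means of `φ : C → D`: the kernel of the difference of the two maps
`M ⊗ C → M ⊗ D ⊗ C` given by the coactions. -/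
def cotensor (φ : C →ₗc[k] D) (M : SuperComodule 𝒟) : Submodule k (M.carrier ⊗[k] C) :=
  LinearMap.ker ((TensorProduct.assoc k M.carrier D C).toLinearMap ∘ₗ M.coact.rTensor C
    - (leftCoact φ).lTensor M.carrier)

theorem cotensor_map_mem (φ : C →ₗc[k] D) {M N : SuperComodule 𝒟} (α : M.Hom N) :
    ∀ z ∈ cotensor φ M, α.toLin.rTensor C z ∈ cotensor φ N := by
  have e₁ : ((TensorProduct.assoc k N.carrier D C).toLinearMap ∘ₗ N.coact.rTensor C) ∘ₗ
      α.toLin.rTensor C = α.toLin.rTensor (D ⊗[k] C) ∘ₗ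
        ((TensorProduct.assoc k M.carrier D C).toLinearMap ∘ₗ M.coact.rTensor C) := by
    rw [LinearMap.comp_assoc, ← LinearMap.rTensor_comp, α.coact_comp, LinearMap.rTensor_comp,
      ← LinearMap.comp_assoc, ← LinearMap.comp_assoc]
    congr 1
    ext m d c
    rfl
  have e₂ : (leftCoact φ).lTensor N.carrier ∘ₗ α.toLin.rTensor C
      = α.toLin.rTensor (D ⊗[k] C) ∘ₗ (leftCoact φ).lTensor M.carrier := by
    rw [LinearMap.lTensor_comp_rTensor, LinearMap.rTensor_comp_lTensor]
  intro z hz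
  have e := congrArg (α.toLin.rTensor (D ⊗[k] C)) (LinearMap.mem_ker.1 hz)
  rw [LinearMap.sub_apply, map_sub, map_zero] at e
  rw [cotensor, LinearMap.mem_ker, LinearMap.sub_apply]
  have h₁ := LinearMap.congr_fun e₁ z
  have h₂ := LinearMap.congr_fun e₂ z
  rw [LinearMap.comp_apply, LinearMap.comp_apply (α.toLin.rTensor (D ⊗[k] C))] at h₁ h₂
  rw [h₁, h₂]
  exact e

/-- The map `α □_D C : M □_D C → N □_D C` induced by a morphism `α : M → N`. -/
def cotensorMap (φ : C →ₗc[k] D) {M N : SuperComodule 𝒟} (α : M.Hom N) :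
    cotensor φ M →ₗ[k] cotensor φ N :=
  (α.toLin.rTensor C).restrict (cotensor_map_mem φ α)

end Cotensor

/-! ### Flat, faithfully flat and surjective maps -/

/-- The `Y`-supermodules, i.e. the right super-comodules over `O_*(Y)`. -/
abbrev Supermodule (Y : SAlgf k ⥤ Type u) : Type (u + 2) := SuperComodule (OStar.grading Y)

/-- The super vector space underlying `f^* M = M □_{O_*(Y)} O_*(X)`, for a `Y`-supermodule `M`. -/
abbrev pullback {X Y : SAlgf k ⥤ Type u} (f : X ⟶ Y) (M : Supermodule Y) : Type (u + 1) :=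
  cotensor (OStar.map f) M

/-- The action of `f^*` on morphisms of `Y`-supermodules. -/
abbrev pullbackMap {X Y : SAlgf k ⥤ Type u} (f : X ⟶ Y) {M N : Supermodule Y} (α : M.Hom N) :
    pullback f M →ₗ[k] pullback f N :=
  cotensorMap (OStar.map f) α

/-- `f : X → Y` is flat if the functor `f^* = - □_{O_*(Y)} O_*(X)` on `Y`-supermodules is exact,
i.e. carries exact sequences to exact sequences. -/
def IsFlat {X Y : SAlgf k ⥤ Type u} (f : X ⟶ Y) : Prop :=
  ∀ (L M N : Supermodule Y) (α : L.Hom M) (β : M.Hom N),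
    Function.Exact α.toLin β.toLin → Function.Exact (pullbackMap f α) (pullbackMap f β)

/-- `f : X → Y` is faithfully flat if the functor `f^*` is faithfully exact: a sequence of
`Y`-supermodules is exact if and only if its image under `f^*` is exact. -/
def IsFaithfullyFlat {X Y : SAlgf k ⥤ Type u} (f : X ⟶ Y) : Prop :=
  ∀ (L M N : Supermodule Y) (α : L.Hom M) (β : M.Hom N),
    Function.Exact α.toLin β.toLin ↔ Function.Exact (pullbackMap f α) (pullbackMap f β)

/-- `f : X → Y` is flat at the point `x` of `X` if the induced map `X_x → Y_y`, `y = f(x)`, is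
flat. -/
def IsFlatAt {X Y : SAlgf k ⥤ Type u} (f : X ⟶ Y) (x : Points X) : Prop :=
  IsFlat (componentMap f x)

/-- `f` is surjective if the map `|f| : |X| → |Y|` is. -/
def IsSurjective {X Y : SAlgf k ⥤ Type u} (f : X ⟶ Y) : Prop :=
  Function.Surjective (Points.map f)

/-- `f` is strictly surjective if the map `O_*(f) : O_*(X) → O_*(Y)` is surjective. -/
def IsStrictlySurjective {X Y : SAlgf k ⥤ Type u} (f : X ⟶ Y) : Prop :=
  Function.Surjective (OStar.map f)

end FormalSuper

end

/-! Write `C` and `D` for the super-coalgebras of `X` and `Y`. The linear forms on `D` are the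
functions on `Y`, that is, the compatible families of elements of the algebras `R` indexed by pairs
`(R, a)` (`Fn.toDual_surjective`), and every `D`-comodule is a module over this algebra of
functions, with finite-dimensional orbits.

Localization. The even part of each `R` is a commutative Artinian ring, so every set of points of
`SSpec R` is cut out by a unique even, hence central, idempotent. Uniqueness makes these idempotents
natural, so every set of points of `|X|` has an idempotent function. The idempotent `e_x` of a
single point splits off the super-coalgebra of `X_x` as a direct summand of `C`, and every element
of `C` is the finite sum of its components. A `D`-comodule `M` has likewise a summand `M_y = e_y M`
over the component `Y_y`. The component at `x` of an element of `M □ C` comes from `M_y □ O_*(X_x)`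
with `y = f(x)` (`map_partVal_map_partProj`), so lifting problems for the cotensor product can be
solved one point at a time; this is part 1.

Faithfulness is proved as the cycle (a) ⇒ (c) ⇒ (b) ⇒ (a). For (a) ⇒ (c), `O_*(f)` is a map of
`D`-comodules whose pullback `C □ C → D □ C = C` is split by the coproduct, hence onto; faithful
exactness reflects this. For (c) ⇒ (b), if `y` is not in the image, then `e_y` pulls back to `0`, so
it vanishes on `D`, although it is nonzero at `y`. For (b) ⇒ (a), the key is
`IsSurjective.exists_mem_cotensor_ne_zero`: a nonzero stable subspace `U` of `M` yields a nonzero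
element of `M □ C` lying in `U ⊗ C`. Inside a minimal stable subspace of `U` the functions act on a
vector through their values at one point `y`; a point of `X` over `y` embeds these values in a
residue field, which allows the element to be written down. Flatness then carries such elements from
images and cokernels back along the given sequence. -/

noncomputable section

namespace FormalSuper

variable {k : Type u} [Field k]

/-! ### Even and odd parts of a superalgebra -/

namespace SAlgf

/-- The projection of a superalgebra onto its component of degree `i`. -/
def pr (R : SAlgf k) (i : ZMod 2) : R.carrier →ₗ[k] R.carrier :=
  GradedAlgebra.proj R.grading i

theorem pr_mem (R : SAlgf k) (i : ZMod 2) (v : R.carrier) : R.pr i v ∈ R.grading i :=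
  SetLike.coe_mem _

theorem pr_of_mem (R : SAlgf k) {i : ZMod 2} {v : R.carrier} (hv : v ∈ R.grading i) :
    R.pr i v = v := by
  rw [pr, GradedAlgebra.proj_apply, DirectSum.decompose_of_mem_same _ hv]

theorem pr_of_mem_ne (R : SAlgf k) {i j : ZMod 2} {v : R.carrier} (hv : v ∈ R.grading i)
    (h : i ≠ j) : R.pr j v = 0 := by
  rw [pr, GradedAlgebra.proj_apply, DirectSum.decompose_of_mem_ne _ hv h]

theorem pr_zero_add_pr_one (R : SAlgf k) (v : R.carrier) : R.pr 0 v + R.pr 1 v = v := by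
  have h := DirectSum.sum_univ_of (DirectSum.decompose R.grading v)
  have h' := congrArg (DirectSum.decompose R.grading).symm h
  rw [Equiv.symm_apply_apply] at h'
  rw [show (Finset.univ : Finset (ZMod 2)) = {0, 1} from rfl, Finset.sum_pair (by decide),
    DirectSum.decompose_symm_add, DirectSum.decompose_symm_of, DirectSum.decompose_symm_of] at h'
  exact h'

theorem Hom.lin_mul {R S : SAlgf k} (h : R ⟶ S) (v w : R.carrier) :
    Hom.lin h (v * w) = Hom.lin h v * Hom.lin h w :=
  map_mul (Hom.gr h).toAlgHom v w

theorem Hom.lin_mem {R S : SAlgf k} (h : R ⟶ S) {i : ZMod 2} {v : R.carrier}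
    (hv : v ∈ R.grading i) : Hom.lin h v ∈ S.grading i :=
  GradedFunLike.map_mem (Hom.gr h) hv

theorem Hom.lin_pr {R S : SAlgf k} (h : R ⟶ S) (i : ZMod 2) (v : R.carrier) :
    Hom.lin h (R.pr i v) = S.pr i (Hom.lin h v) :=
  map_directSumDecompose (𝒜 := R.grading) (ℬ := S.grading) (Hom.gr h)

theorem mul_comm_of_even (R : SAlgf k) {v : R.carrier} (hv : v ∈ R.grading 0) (w : R.carrier) :
    v * w = w * v := R.even_central v hv w

theorem odd_anticomm (R : SAlgf k) {v w : R.carrier} (hv : v ∈ R.grading 1)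
    (hw : w ∈ R.grading 1) : v * w = -(w * v) := by
  have h := R.odd_sq _ (add_mem hv hw)
  rw [add_mul, mul_add, mul_add, R.odd_sq _ hv, R.odd_sq _ hw, zero_add, add_zero] at h
  exact eq_neg_of_add_eq_zero_left h

theorem odd_mul_odd_sq (R : SAlgf k) {v w : R.carrier} (hv : v ∈ R.grading 1)
    (hw : w ∈ R.grading 1) : (v * w) * (v * w) = 0 := by
  have h : w * v = -(v * w) := R.odd_anticomm hw hv
  calc (v * w) * (v * w) = v * (w * v) * w := by simp only [mul_assoc]
    _ = -(v * v * (w * w)) := by rw [h]; simp only [mul_neg, neg_mul, mul_assoc]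
    _ = 0 := by rw [R.odd_sq _ hv]; simp

theorem mul_mem_grading (R : SAlgf k) {i j : ZMod 2} {v w : R.carrier} (hv : v ∈ R.grading i)
    (hw : w ∈ R.grading j) : v * w ∈ R.grading (i + j) :=
  SetLike.mul_mem_graded hv hw

/-- The even component of a product. -/
theorem pr_zero_mul (R : SAlgf k) (v w : R.carrier) :
    R.pr 0 (v * w) = R.pr 0 v * R.pr 0 w + R.pr 1 v * R.pr 1 w := by
  conv_lhs => rw [← R.pr_zero_add_pr_one v, ← R.pr_zero_add_pr_one w]
  simp only [add_mul, mul_add, map_add]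
  have h₀ : R.pr 0 (R.pr 0 v * R.pr 0 w) = _ :=
    R.pr_of_mem (R.mul_mem_grading (R.pr_mem 0 v) (R.pr_mem 0 w))
  have h₁ : R.pr 0 (R.pr 1 v * R.pr 1 w) = _ :=
    R.pr_of_mem (R.mul_mem_grading (R.pr_mem 1 v) (R.pr_mem 1 w))
  rw [h₀, h₁,
    R.pr_of_mem_ne (R.mul_mem_grading (R.pr_mem 1 v) (R.pr_mem 0 w)) (by decide),
    R.pr_of_mem_ne (R.mul_mem_grading (R.pr_mem 0 v) (R.pr_mem 1 w)) (by decide)]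
  simp

theorem one_mem_grading (R : SAlgf k) : (1 : R.carrier) ∈ R.grading 0 :=
  SetLike.GradedOne.one_mem

/-- The even part of a superalgebra. -/
abbrev Even (R : SAlgf k) : Type u := R.grading 0

instance (R : SAlgf k) : CommRing R.Even :=
  { (inferInstance : Ring R.Even) with
    mul_comm := fun a b => Subtype.ext (R.even_central a.1 a.2 b.1) }

instance (R : SAlgf k) : Module.Finite k R.Even :=
  inferInstanceAs (Module.Finite k (R.grading 0))

instance (R : SAlgf k) : IsArtinianRing R.Even :=
  IsArtinianRing.of_finite k R.Even

/-- The inclusion of the even part. -/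
def evenVal (R : SAlgf k) : R.Even →+* R.carrier where
  toFun := Subtype.val
  map_one' := rfl
  map_mul' _ _ := rfl
  map_zero' := rfl
  map_add' _ _ := rfl

/-- The projection onto the even part. -/
def toEven (R : SAlgf k) : R.carrier →ₗ[k] R.Even :=
  (R.pr 0).codRestrict _ (R.pr_mem 0)

theorem toEven_val (R : SAlgf k) (v : R.Even) : R.toEven v.1 = v :=
  Subtype.ext (R.pr_of_mem v.2)

/-- The defect is the product of the two odd parts, whose square vanishes by anticommutativity. So
the even projection, though not a ring homomorphism, is multiplicative modulo every prime of the
even part. -/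
theorem toEven_mul_sub_sq (R : SAlgf k) (v w : R.carrier) :
    (R.toEven (v * w) - R.toEven v * R.toEven w) ^ 2 = 0 := by
  have h : R.toEven (v * w) - R.toEven v * R.toEven w
      = ⟨R.pr 1 v * R.pr 1 w, R.mul_mem_grading (R.pr_mem 1 v) (R.pr_mem 1 w)⟩ := by
    apply Subtype.ext
    change R.pr 0 (v * w) - R.pr 0 v * R.pr 0 w = _
    rw [pr_zero_mul]
    simp
  rw [h, sq]
  exact Subtype.ext (R.odd_mul_odd_sq (R.pr_mem 1 v) (R.pr_mem 1 w))

theorem toEven_mul_mem_iff (R : SAlgf k) (q : PrimeSpectrum R.Even) (v w : R.carrier) :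
    R.toEven (v * w) ∈ q.asIdeal ↔ R.toEven v * R.toEven w ∈ q.asIdeal := by
  have h : R.toEven (v * w) - R.toEven v * R.toEven w ∈ q.asIdeal :=
    q.2.mem_of_pow_mem 2 (by rw [toEven_mul_sub_sq]; exact zero_mem _)
  exact ⟨fun h' => (Submodule.sub_mem_iff_right _ h').1 h,
    fun h' => (Submodule.sub_mem_iff_left _ h').1 h⟩

end SAlgf

/-! ### Prime superideals -/

namespace SSpec

variable {R : SAlgf k}

theorem odd_mem (p : SSpec R) {v : R.carrier} (hv : v ∈ R.grading 1) : v ∈ p.1 :=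
  (p.2.1.mem_or_mem (show v * v ∈ p.1 by rw [R.odd_sq v hv]; exact zero_mem _)).elim id id

theorem pr_zero_mem_iff (p : SSpec R) (v : R.carrier) : R.pr 0 v ∈ p.1 ↔ v ∈ p.1 := by
  conv_rhs => rw [← R.pr_zero_add_pr_one v]
  exact (Submodule.add_mem_iff_left _ (p.odd_mem (R.pr_mem 1 v))).symm

theorem one_notMem (p : SSpec R) : (1 : R.carrier) ∉ p.1 :=
  (Ideal.ne_top_iff_one _).1 p.2.1.ne_top

/-- The prime ideal of the even part defined by a prime superideal. -/
def toPrime (p : SSpec R) : PrimeSpectrum R.Even :=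
  ⟨p.1.comap R.evenVal, by have := p.2.1; exact Ideal.comap_isPrime _ _⟩

theorem toEven_mem_toPrime (p : SSpec R) (v : R.carrier) :
    R.toEven v ∈ p.toPrime.asIdeal ↔ v ∈ p.1 :=
  p.pr_zero_mem_iff v

/-- The prime superideal defined by a prime ideal of the even part. -/
def ofPrime (q : PrimeSpectrum R.Even) : SSpec R :=
  ⟨{ carrier := {v | R.toEven v ∈ q.asIdeal}
     add_mem' := fun ha hb => by
       simp only [Set.mem_ofPred_eq, map_add] at *
       exact add_mem ha hb
     zero_mem' := by simp
     smul_mem' := fun c v hv => by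
       simp only [Set.mem_ofPred_eq, smul_eq_mul] at *
       rw [R.toEven_mul_mem_iff]
       exact Ideal.mul_mem_left _ _ hv },
   { ne_top' := by
       rw [Ideal.ne_top_iff_one]
       intro h
       refine (Ideal.ne_top_iff_one _).1 q.2.ne_top ?_
       have h' : R.toEven 1 ∈ q.asIdeal := h
       rwa [show R.toEven 1 = 1 from R.toEven_val 1] at h'
     mem_or_mem' := fun {v w} h => by
       have h' : R.toEven (v * w) ∈ q.asIdeal := h
       rw [R.toEven_mul_mem_iff] at h'
       exact q.2.mem_or_mem h' },
   fun i v hv => by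
     have hv' : R.toEven v ∈ q.asIdeal := hv
     change R.toEven (R.pr i v) ∈ q.asIdeal
     fin_cases i
     · have : R.toEven (R.pr 0 v) = R.toEven v := Subtype.ext (R.pr_of_mem (R.pr_mem 0 v))
       exact this ▸ hv'
     · have : R.toEven (R.pr 1 v) = 0 :=
         Subtype.ext (R.pr_of_mem_ne (R.pr_mem 1 v) (by decide))
       exact this ▸ zero_mem _⟩

theorem mem_ofPrime (q : PrimeSpectrum R.Even) (v : R.carrier) :
    v ∈ (ofPrime q).1 ↔ R.toEven v ∈ q.asIdeal := Iff.rfl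

theorem ofPrime_toPrime (p : SSpec R) : ofPrime p.toPrime = p :=
  Subtype.ext (Ideal.ext fun v => p.toEven_mem_toPrime v)

theorem mem_comap {S : SAlgf k} (h : R ⟶ S) (p : SSpec S) (v : R.carrier) :
    v ∈ (SSpec.comap h p).1 ↔ SAlgf.Hom.lin h v ∈ p.1 := Iff.rfl

/-- A prime superideal contains every odd element, so it is determined by its trace on the Artinian
ring `R.Even`. -/
instance : Finite (SSpec R) :=
  Finite.of_injective (toPrime (R := R))
    (Function.LeftInverse.injective (g := ofPrime) ofPrime_toPrime)

end SSpec

/-! ### Idempotents and residue fields of a superalgebra. -/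

namespace SAlgf

theorem isNilpotent_of_forall_mem (R : SAlgf k) {v : R.carrier} (hv : v ∈ R.grading 0)
    (h : ∀ p : SSpec R, v ∈ p.1) : IsNilpotent v := by
  have h' : IsNilpotent (⟨v, hv⟩ : R.Even) := by
    rw [nilpotent_iff_mem_prime]
    intro J hJ
    have := h (SSpec.ofPrime ⟨J, hJ⟩)
    rw [SSpec.mem_ofPrime] at this
    rwa [← R.toEven_val ⟨v, hv⟩]
  exact h'.map R.evenVal

/-- A set of points of `SSpec R` is the set of points at which a unique even idempotent does not
vanish. -/
theorem exists_idem (R : SAlgf k) (S : Set (SSpec R)) :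
    ∃ e ∈ R.grading 0, e * e = e ∧ ∀ p : SSpec R, e ∈ p.1 ↔ p ∉ S := by
  -- The spectrum of an Artinian ring is discrete, so every subset is open and closed.
  obtain ⟨e, he, h⟩ := PrimeSpectrum.exists_idempotent_basicOpen_eq_of_isClopen
    (s := {q : PrimeSpectrum R.Even | SSpec.ofPrime q ∈ S}) (isClopen_discrete _)
  refine ⟨e.1, e.2, congrArg Subtype.val he, fun p => ?_⟩
  have h' := Set.ext_iff.1 h p.toPrime
  rw [Set.mem_ofPred_eq, SSpec.ofPrime_toPrime] at h'
  rw [h', SetLike.mem_coe, PrimeSpectrum.mem_basicOpen, not_not]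
  exact Iff.rfl

theorem idem_unique (R : SAlgf k) {e e' : R.carrier} (he : e ∈ R.grading 0)
    (he' : e' ∈ R.grading 0) (h : e * e = e) (h' : e' * e' = e')
    (H : ∀ p : SSpec R, e ∈ p.1 ↔ e' ∈ p.1) : e = e' := by
  have := PrimeSpectrum.basicOpen_injOn_isIdempotentElem (R := R.Even)
    (show (⟨e, he⟩ : R.Even) ∈ {e | IsIdempotentElem e} from Subtype.ext h)
    (show (⟨e', he'⟩ : R.Even) ∈ {e | IsIdempotentElem e} from Subtype.ext h') (by
      ext q
      have := H (SSpec.ofPrime q)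
      rw [SSpec.mem_ofPrime, SSpec.mem_ofPrime] at this
      simp only [SetLike.mem_coe, PrimeSpectrum.mem_basicOpen, not_iff_not]
      rwa [← R.toEven_val ⟨e, he⟩, ← R.toEven_val ⟨e', he'⟩])
  exact congrArg Subtype.val this

/-- The even idempotent that is `1` on `S` and `0` outside `S`. -/
def idem (R : SAlgf k) (S : Set (SSpec R)) : R.carrier := (R.exists_idem S).choose

variable (R : SAlgf k) (S T : Set (SSpec R))

theorem idem_mem : R.idem S ∈ R.grading 0 := (R.exists_idem S).choose_spec.1

theorem idem_mul_self : R.idem S * R.idem S = R.idem S := (R.exists_idem S).choose_spec.2.1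

theorem idem_mem_iff (p : SSpec R) : R.idem S ∈ p.1 ↔ p ∉ S :=
  (R.exists_idem S).choose_spec.2.2 p

variable {S} in
theorem eq_idem {e : R.carrier} (he : e ∈ R.grading 0) (h : e * e = e)
    (H : ∀ p : SSpec R, e ∈ p.1 ↔ p ∉ S) : e = R.idem S :=
  R.idem_unique he (R.idem_mem S) h (R.idem_mul_self S)
    fun p => (H p).trans (R.idem_mem_iff S p).symm

theorem idem_comm (v : R.carrier) : R.idem S * v = v * R.idem S :=
  R.even_central _ (R.idem_mem S) v

theorem idem_univ : R.idem Set.univ = 1 :=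
  (R.eq_idem R.one_mem_grading (one_mul 1) fun p => by simp [p.one_notMem]).symm

theorem idem_empty : R.idem ∅ = 0 :=
  (R.eq_idem (zero_mem _) (zero_mul 0) fun p => by simp).symm

theorem idem_mul : R.idem S * R.idem T = R.idem (S ∩ T) := by
  refine R.eq_idem (R.mul_mem_grading (R.idem_mem S) (R.idem_mem T)) ?_ fun p => ?_
  · rw [mul_assoc, ← mul_assoc (R.idem T), R.idem_comm T, mul_assoc, R.idem_mul_self, ← mul_assoc,
      R.idem_mul_self]
  · have := p.2.1
    rw [Set.mem_inter_iff, not_and_or, ← R.idem_mem_iff, ← R.idem_mem_iff]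
    refine ⟨fun h => p.2.1.mem_or_mem h, ?_⟩
    rintro (h | h)
    · rw [R.idem_comm]; exact Ideal.mul_mem_left _ _ h
    · exact Ideal.mul_mem_left _ _ h

variable {S T} in
theorem idem_union (h : Disjoint S T) : R.idem (S ∪ T) = R.idem S + R.idem T := by
  have h₀ : R.idem S * R.idem T = 0 := by rw [idem_mul, h.inter_eq, idem_empty]
  have h₀' : R.idem T * R.idem S = 0 := by rw [idem_mul, Set.inter_comm, h.inter_eq, idem_empty]
  refine (R.eq_idem (add_mem (R.idem_mem S) (R.idem_mem T)) ?_ fun p => ?_).symm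
  · rw [add_mul, mul_add, mul_add, h₀, h₀', idem_mul_self, idem_mul_self, zero_add, add_zero]
  · rw [Set.mem_union, not_or, ← R.idem_mem_iff, ← R.idem_mem_iff]
    refine ⟨fun hp => ⟨?_, ?_⟩, fun hp => add_mem hp.1 hp.2⟩
    · have := Ideal.mul_mem_left _ (R.idem S) hp
      rwa [mul_add, idem_mul_self, h₀, add_zero] at this
    · have := Ideal.mul_mem_left _ (R.idem T) hp
      rwa [mul_add, idem_mul_self, h₀', zero_add] at this

/-- The image is again an even idempotent, with the pulled-back vanishing set, and such an
idempotent is unique. This naturality is what makes the idempotents of the individual algebras into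
functions on `X`. -/
theorem Hom.lin_idem {R R' : SAlgf k} (h : R ⟶ R') (S : Set (SSpec R)) :
    Hom.lin h (R.idem S) = R'.idem (SSpec.comap h ⁻¹' S) := by
  refine R'.eq_idem (Hom.lin_mem h (R.idem_mem S)) ?_ fun p => ?_
  · rw [← Hom.lin_mul, idem_mul_self]
  · rw [← SSpec.mem_comap, idem_mem_iff]
    exact Iff.rfl

/-- The residue field of a superalgebra at a prime superideal. -/
theorem exists_residueField {R : SAlgf k} (p : SSpec R) :
    ∃ (L : Type u) (_ : Field L) (_ : Algebra k L) (_ : FiniteDimensional k L)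
      (χ : R.carrier →ₐ[k] L), ∀ v, χ v = 0 ↔ v ∈ p.1 := by
  have := p.toPrime.2
  have hm : p.toPrime.asIdeal.IsMaximal := Ideal.IsPrime.isMaximal' ‹_›
  let _ := Ideal.Quotient.field p.toPrime.asIdeal
  let χ : R.carrier →ₗ[k] R.Even ⧸ p.toPrime.asIdeal :=
    (Ideal.Quotient.mkₐ k p.toPrime.asIdeal).toLinearMap ∘ₗ R.toEven
  refine ⟨R.Even ⧸ p.toPrime.asIdeal, inferInstance, inferInstance, inferInstance,
    AlgHom.ofLinearMap χ ?_ ?_, fun v => ?_⟩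
  · change Ideal.Quotient.mk _ (R.toEven 1) = 1
    rw [show R.toEven 1 = 1 from R.toEven_val 1, map_one]
  · intro v w
    change Ideal.Quotient.mk _ (R.toEven (v * w))
      = Ideal.Quotient.mk _ (R.toEven v) * Ideal.Quotient.mk _ (R.toEven w)
    rw [← map_mul, Ideal.Quotient.eq]
    -- The defect of multiplicativity of the even projection squares to zero, hence lies in the
    -- prime.
    exact Ideal.IsPrime.mem_of_pow_mem ‹_› 2 (by rw [toEven_mul_sub_sq]; exact zero_mem _)
  · rw [← p.toEven_mem_toPrime]
    exact Ideal.Quotient.eq_zero_iff_mem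

end SAlgf

/-! ### Contraction with linear forms -/

section Contraction

variable {M N C D : Type*} [AddCommGroup M] [Module k M] [AddCommGroup N] [Module k N]
  [AddCommGroup C] [Module k C] [AddCommGroup D] [Module k D]

/-- The contraction `m ⊗ d ↦ f(d) m` with a linear form `f`. -/
def contract (M : Type*) [AddCommGroup M] [Module k M] (f : Module.Dual k D) :
    M ⊗[k] D →ₗ[k] M :=
  (TensorProduct.rid k M).toLinearMap ∘ₗ f.lTensor M

@[simp] theorem contract_tmul (f : Module.Dual k D) (m : M) (d : D) :
    contract M f (m ⊗ₜ d) = f d • m := by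
  simp [contract]

theorem contract_rTensor (f : Module.Dual k D) (α : M →ₗ[k] N) (t : M ⊗[k] D) :
    contract N f (α.rTensor D t) = α (contract M f t) := by
  induction t using TensorProduct.induction_on with
  | zero => simp
  | tmul m d => simp
  | add x y hx hy => simp only [map_add, hx, hy]

theorem contract_lTensor (f : Module.Dual k D) (φ : C →ₗ[k] D) (t : M ⊗[k] C) :
    contract M f (φ.lTensor M t) = contract M (f ∘ₗ φ) t := by
  induction t using TensorProduct.induction_on with
  | zero => simp
  | tmul m d => simp
  | add x y hx hy => simp only [map_add, hx, hy]

theorem contract_map (f : Module.Dual k D) (α : M →ₗ[k] N) (φ : C →ₗ[k] D) (t : M ⊗[k] C) :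
    contract N f (TensorProduct.map α φ t) = α (contract M (f ∘ₗ φ) t) := by
  rw [← LinearMap.lTensor_comp_rTensor, LinearMap.comp_apply, contract_lTensor, contract_rTensor]

/-- The contraction `d ⊗ m ↦ f(d) m` with a linear form `f`. -/
def contractLeft (M : Type*) [AddCommGroup M] [Module k M] (f : Module.Dual k D) :
    D ⊗[k] M →ₗ[k] M :=
  (TensorProduct.lid k M).toLinearMap ∘ₗ f.rTensor M

@[simp] theorem contractLeft_tmul (f : Module.Dual k D) (m : M) (d : D) :
    contractLeft M f (d ⊗ₜ m) = f d • m := by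
  simp [contractLeft]

theorem contractLeft_map (f : Module.Dual k D) (α : M →ₗ[k] N) (φ : C →ₗ[k] D) (t : C ⊗[k] M) :
    contractLeft N f (TensorProduct.map φ α t) = α (contractLeft M (f ∘ₗ φ) t) := by
  induction t using TensorProduct.induction_on with
  | zero => simp
  | tmul m d => simp
  | add x y hx hy => simp only [map_add, hx, hy]

theorem lTensor_contract_assoc (f : Module.Dual k D) (t : (M ⊗[k] C) ⊗[k] D) :
    (contract C f).lTensor M (TensorProduct.assoc k M C D t) = contract (M ⊗[k] C) f t := by
  have : (contract C f).lTensor M ∘ₗ (TensorProduct.assoc k M C D).toLinearMap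
      = contract (M ⊗[k] C) f := by
    ext m d c
    simp
  exact LinearMap.congr_fun this t

theorem lTensor_contractLeft_assoc (f : Module.Dual k D) (t : (M ⊗[k] D) ⊗[k] C) :
    (contractLeft C f).lTensor M (TensorProduct.assoc k M D C t) = (contract M f).rTensor C t := by
  have : (contractLeft C f).lTensor M ∘ₗ (TensorProduct.assoc k M D C).toLinearMap
      = (contract M f).rTensor C := by
    ext m d c
    simp [TensorProduct.smul_tmul']
  exact LinearMap.congr_fun this t

theorem contract_linear (t : M ⊗[k] D) :
    ∃ F : Module.Dual k D →ₗ[k] M, ∀ f, F f = contract M f t :=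
  ⟨(TensorProduct.rid k M).toLinearMap ∘ₗ LinearMap.applyₗ t ∘ₗ LinearMap.lTensorHom M,
    fun _ => rfl⟩

/-- The linear forms on `D` separate the elements of `M ⊗ D`. -/
theorem eq_zero_of_contract {t : M ⊗[k] D} (h : ∀ f : Module.Dual k D, contract M f t = 0) :
    t = 0 := by
  classical
  let b := Module.Basis.ofVectorSpace k D
  apply (TensorProduct.equivFinsuppOfBasisRight (M := M) b).injective
  ext i
  rw [map_zero, TensorProduct.equivFinsuppOfBasisRight_apply]
  exact h (b.coord i)

theorem eq_of_contract {t t' : M ⊗[k] D}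
    (h : ∀ f : Module.Dual k D, contract M f t = contract M f t') : t = t' :=
  sub_eq_zero.1 (eq_zero_of_contract fun f => by rw [map_sub, h, sub_self])

/-- Allows the cotensor condition, an equation in a threefold tensor product, to be tested on pairs
of linear forms. -/
theorem eq_of_contract₂ {t t' : M ⊗[k] (D ⊗[k] C)}
    (h : ∀ (f : Module.Dual k D) (g : Module.Dual k C),
      contract M f ((contract D g).lTensor M t) = contract M f ((contract D g).lTensor M t')) :
    t = t' := by
  apply (TensorProduct.assoc k M D C).symm.injective
  refine eq_of_contract fun g => ?_
  rw [← lTensor_contract_assoc, ← lTensor_contract_assoc, LinearEquiv.apply_symm_apply,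
    LinearEquiv.apply_symm_apply]
  exact eq_of_contract fun f => h f g

end Contraction

/-! ### The action of linear forms on comodules -/

section Action

variable {M D : Type w} [AddCommGroup M] [Module k M] [AddCommGroup D] [Module k D]
  [Coalgebra k D]

/-- The map `d ↦ d₁ f(d₂)`. -/
def rightMul (f : Module.Dual k D) : D →ₗ[k] D := contract D f ∘ₗ Coalgebra.comul

/-- The map `d ↦ f(d₁) d₂`. -/
def leftMul (f : Module.Dual k D) : D →ₗ[k] D := contractLeft D f ∘ₗ Coalgebra.comul

/-- Coassociativity with `f` applied to the last of the three tensor factors. -/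
theorem coact_contract {ρ : M →ₗ[k] M ⊗[k] D}
    (hρ : (TensorProduct.assoc k M D D).toLinearMap ∘ₗ ρ.rTensor D ∘ₗ ρ
      = (Coalgebra.comul (R := k) (A := D)).lTensor M ∘ₗ ρ) (f : Module.Dual k D) (m : M) :
    ρ (contract M f (ρ m)) = (rightMul f).lTensor M (ρ m) := by
  rw [← contract_rTensor, ← lTensor_contract_assoc, rightMul, LinearMap.lTensor_comp_apply]
  exact congrArg _ (LinearMap.congr_fun hρ m)

/-- Coassociativity with `f` applied to the middle factor. -/
theorem contract_rTensor_coact {ρ : M →ₗ[k] M ⊗[k] D}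
    (hρ : (TensorProduct.assoc k M D D).toLinearMap ∘ₗ ρ.rTensor D ∘ₗ ρ
      = (Coalgebra.comul (R := k) (A := D)).lTensor M ∘ₗ ρ) (f : Module.Dual k D) (m : M) :
    (contract M f ∘ₗ ρ).rTensor D (ρ m) = (leftMul f).lTensor M (ρ m) := by
  rw [LinearMap.rTensor_comp_apply, ← lTensor_contractLeft_assoc, leftMul,
    LinearMap.lTensor_comp_apply]
  exact congrArg _ (LinearMap.congr_fun hρ m)

theorem contract_contract {ρ : M →ₗ[k] M ⊗[k] D}
    (hρ : (TensorProduct.assoc k M D D).toLinearMap ∘ₗ ρ.rTensor D ∘ₗ ρ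
      = (Coalgebra.comul (R := k) (A := D)).lTensor M ∘ₗ ρ) (f g : Module.Dual k D) (m : M) :
    contract M f (ρ (contract M g (ρ m))) = contract M (f ∘ₗ rightMul g) (ρ m) := by
  rw [coact_contract hρ, contract_lTensor]

theorem comul_rightMul (f : Module.Dual k D) (d : D) :
    Coalgebra.comul (R := k) (rightMul f d) = (rightMul f).lTensor D (Coalgebra.comul (R := k) d) :=
  coact_contract Coalgebra.coassoc f d

end Action

/-! ### Functions on a formal super functor -/

theorem OStar.induction {X : SAlgf k ⥤ Type u} {P : OStar X → Prop} (zero : P 0)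
    (add : ∀ c d, P c → P d → P (c + d)) (of : ∀ a g, P (OStar.of a g)) (c : OStar X) : P c := by
  classical
  obtain ⟨c, rfl⟩ := (relations X).mkQ_surjective c
  induction c using DFinsupp.induction with
  | h0 => exact zero
  | ha a g c _ _ h =>
    exact (congrArg P (map_add (relations X).mkQ (PreOStar.of a g) c)).mpr (add _ _ (of a g) h)

/-- The functions on `X`: the compatible families of elements `v a ∈ R`, for `a ∈ X(R)`. -/
def Fn (X : SAlgf k ⥤ Type u) : Subalgebra k (∀ a : Pair X, a.alg.carrier) where
  carrier := {v | ∀ {a b : Pair X} (h : a.Hom b), SAlgf.Hom.lin h.hom (v a) = v b}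
  mul_mem' hv hw a b h := by simp only [Pi.mul_apply, SAlgf.Hom.lin_mul, hv h, hw h]
  add_mem' hv hw a b h := by simp only [Pi.add_apply, map_add, hv h, hw h]
  algebraMap_mem' c a b h := (SAlgf.Hom.gr h.hom).toAlgHom.commutes c

namespace Fn

variable {X Y : SAlgf k ⥤ Type u}

theorem compat (v : Fn X) {a b : Pair X} (h : a.Hom b) :
    SAlgf.Hom.lin h.hom (v.1 a) = v.1 b := v.2 h

/-- The linear form on `O_*(X)` defined by a function on `X`. -/
def toDual : Fn X →ₗ[k] Module.Dual k (OStar X) where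
  toFun v := OStar.lift (fun a => LinearMap.applyₗ (v.1 a)) (fun h => by
    ext g
    exact congrArg g (compat v h))
  map_add' v w := OStar.hom_ext fun a => LinearMap.ext fun g => by
    simp only [LinearMap.comp_apply, LinearMap.add_apply, OStar.lift_of]
    exact map_add g _ _
  map_smul' c v := OStar.hom_ext fun a => LinearMap.ext fun g => by
    simp only [LinearMap.comp_apply, LinearMap.smul_apply, OStar.lift_of]
    exact map_smul g _ _

theorem toDual_of (v : Fn X) (a : Pair X) (g : Module.Dual k a.alg.carrier) :
    toDual v (OStar.of a g) = g (v.1 a) :=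
  OStar.lift_of (fun a => LinearMap.applyₗ (v.1 a))
    (fun h => LinearMap.ext fun g => congrArg g (compat v h)) a g

/-- On each `R^*` a linear form is evaluation at an element of `R`, by finite-dimensionality, and
the relations in the inductive limit make these elements compatible. Testing against functions is
therefore the same as testing against all linear forms. -/
theorem toDual_surjective : Function.Surjective (toDual (X := X)) := by
  intro f
  have key : ∀ (a : Pair X) (g : Module.Dual k a.alg.carrier),
      g ((Module.evalEquiv k a.alg.carrier).symm (f ∘ₗ OStar.of a)) = f (OStar.of a g) := by
    intro a g
    exact Module.apply_evalEquiv_symm_apply k a.alg.carrier g (f ∘ₗ OStar.of a)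
  refine ⟨⟨fun a => (Module.evalEquiv k a.alg.carrier).symm (f ∘ₗ OStar.of a), ?_⟩, ?_⟩
  · intro a b h
    refine Module.forall_dual_apply_eq_zero_iff k _ |>.1 (fun g => ?_) |> sub_eq_zero.1
    rw [map_sub, key, sub_eq_zero]
    have := key a (dualMap h.hom g)
    rw [← LinearMap.congr_fun (OStar.of_comp_dualMap h) g]
    exact this
  · refine OStar.hom_ext fun a => LinearMap.ext fun g => ?_
    rw [LinearMap.comp_apply, toDual_of, key]
    rfl

theorem toDual_one : toDual (1 : Fn X) = Coalgebra.counit :=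
  OStar.hom_ext fun a => LinearMap.ext fun g => by
    rw [LinearMap.comp_apply, toDual_of, LinearMap.comp_apply, OStar.counit_of]
    rfl

theorem contract_dual (R : SAlgf k) (v : R.carrier)
    (t : Module.Dual k R.carrier ⊗[k] Module.Dual k R.carrier) (a : R.carrier) :
    contract _ (LinearMap.applyₗ v) t a
      = TensorProduct.dualDistrib k R.carrier R.carrier t (a ⊗ₜ v) := by
  induction t using TensorProduct.induction_on with
  | zero => simp
  | tmul f g => simp [mul_comm]
  | add x y hx hy => simp only [map_add, LinearMap.add_apply, hx, hy]

theorem contractLeft_dual (R : SAlgf k) (v : R.carrier)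
    (t : Module.Dual k R.carrier ⊗[k] Module.Dual k R.carrier) (a : R.carrier) :
    contractLeft _ (LinearMap.applyₗ v) t a
      = TensorProduct.dualDistrib k R.carrier R.carrier t (v ⊗ₜ a) := by
  induction t using TensorProduct.induction_on with
  | zero => simp
  | tmul f g => simp
  | add x y hx hy => simp only [map_add, LinearMap.add_apply, hx, hy]

/-- The coproduct is transposed to `a ⊗ b ↦ b a`, so contracting the second factor puts `v` on the
left of the argument. -/
theorem rightMul_of (v : Fn X) (a : Pair X) (g : Module.Dual k a.alg.carrier) :
    rightMul (toDual v) (OStar.of a g) = OStar.of a (g ∘ₗ LinearMap.mulLeft k (v.1 a)) := by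
  rw [rightMul, LinearMap.comp_apply, OStar.comul_of, contract_map]
  congr 1
  ext x
  rw [show toDual v ∘ₗ OStar.of a = LinearMap.applyₗ (v.1 a) from
    LinearMap.ext fun g => toDual_of v a g, contract_dual, dual_comul_apply]
  rfl

theorem leftMul_of (v : Fn X) (a : Pair X) (g : Module.Dual k a.alg.carrier) :
    leftMul (toDual v) (OStar.of a g) = OStar.of a (g ∘ₗ LinearMap.mulRight k (v.1 a)) := by
  rw [leftMul, LinearMap.comp_apply, OStar.comul_of, contractLeft_map]
  congr 1
  ext x
  rw [show toDual v ∘ₗ OStar.of a = LinearMap.applyₗ (v.1 a) from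
    LinearMap.ext fun g => toDual_of v a g, contractLeft_dual, dual_comul_apply]
  rfl

theorem toDual_comp_rightMul (v w : Fn X) :
    toDual v ∘ₗ rightMul (toDual w) = toDual (w * v) :=
  OStar.hom_ext fun a => LinearMap.ext fun g => by
    simp only [LinearMap.comp_apply, rightMul_of, toDual_of]
    rfl

theorem eq_of_apply {v w : Fn X} (h : ∀ a, v.1 a = w.1 a) : v = w := Subtype.ext (funext h)

/-- The component of degree `i` of a function. -/
def pr (i : ZMod 2) (v : Fn X) : Fn X :=
  ⟨fun a => a.alg.pr i (v.1 a), fun h => by rw [SAlgf.Hom.lin_pr, compat v h]⟩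

theorem pr_zero_add_pr_one (v : Fn X) : pr 0 v + pr 1 v = v :=
  eq_of_apply fun a => a.alg.pr_zero_add_pr_one _

/-- The pullback of functions. -/
def comap (f : X ⟶ Y) : Fn Y →ₐ[k] Fn X where
  toFun v := ⟨fun a => v.1 (a.map f), fun h => compat v (h.map f)⟩
  map_one' := rfl
  map_mul' _ _ := rfl
  map_zero' := rfl
  map_add' _ _ := rfl
  commutes' _ := rfl

theorem toDual_comp_map (f : X ⟶ Y) (v : Fn Y) :
    toDual v ∘ₗ (OStar.map f).toLinearMap = toDual (comap f v) :=
  OStar.hom_ext fun a => LinearMap.ext fun g => by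
    simp only [LinearMap.comp_apply, toDual_of]
    exact (congrArg _ (OStar.mapLin_of f a g)).trans (toDual_of _ _ _)

/-- The idempotent function with value `1` on a set of points and `0` elsewhere. -/
def idem (F : Set (Points X)) : Fn X :=
  ⟨fun a => a.alg.idem {p | Points.mk a.elt p ∈ F}, fun {a b} h => by
    rw [SAlgf.Hom.lin_idem]
    congr 1
    ext p
    change Points.mk a.elt (SSpec.comap h.hom p) ∈ F ↔ Points.mk b.elt p ∈ F
    rw [← Points.mk_map, h.map_elt]⟩

theorem idem_mul (F G : Set (Points X)) : idem F * idem G = idem (F ∩ G) :=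
  eq_of_apply fun a => a.alg.idem_mul _ _

theorem idem_mul_self (F : Set (Points X)) : idem F * idem F = idem F := by
  rw [idem_mul, Set.inter_self]

theorem comap_idem (f : X ⟶ Y) (F : Set (Points Y)) :
    comap f (idem F) = idem (Points.map f ⁻¹' F) := rfl

/-- Idempotents are even, hence central. This permits passing from one side of `O_*(X)` to the
other. -/
theorem rightMul_idem (F : Set (Points X)) :
    rightMul (toDual (idem F)) = leftMul (toDual (idem F)) :=
  OStar.hom_ext fun a => LinearMap.ext fun g => by
    rw [LinearMap.comp_apply, LinearMap.comp_apply, rightMul_of, leftMul_of]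
    congr 2
    ext x
    exact a.alg.idem_comm _ _

theorem sum_idem_apply (a : Pair X) (F : Finset (Points X)) :
    ∑ x ∈ F, (idem {x}).1 a = (idem (F : Set (Points X))).1 a := by
  classical
  induction F using Finset.induction_on with
  | empty =>
    rw [Finset.sum_empty]
    refine (a.alg.idem_empty.symm.trans ?_)
    simp [idem]
  | insert x F hx ih =>
    rw [Finset.sum_insert hx, ih]
    refine (a.alg.idem_union ?_).symm.trans ?_
    · rw [Set.disjoint_left]
      intro p hp hp'
      exact hx ((show Points.mk a.elt p = x from hp) ▸ hp')
    · change _ = a.alg.idem _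
      congr 1
      ext p
      simp

/-- The idempotents at the points of `X` add up to the counit on every element of `O_*(X)`. -/
theorem exists_sum_rightMul (c : OStar X) : ∃ F : Finset (Points X), ∀ F', F ⊆ F' →
    ∑ x ∈ F', rightMul (toDual (idem {x})) c = c := by
  classical
  induction c using OStar.induction with
  | zero => exact ⟨∅, fun F' _ => by simp⟩
  | add c d hc hd =>
    obtain ⟨F, hF⟩ := hc
    obtain ⟨G, hG⟩ := hd
    refine ⟨F ∪ G, fun F' h => ?_⟩
    simp only [map_add, Finset.sum_add_distrib]
    rw [hF _ (Finset.union_subset_left h), hG _ (Finset.union_subset_right h)]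
  | of a g =>
    -- Only the finitely many points defined by `SSpec R` matter: the idempotent of any set
    -- containing them has value `1` at the pair. Allowing all larger finite sets lets the sets for
    -- two summands be merged.
    refine ⟨(Set.finite_range (fun p : SSpec a.alg => Points.mk a.elt p)).toFinset,
      fun F' h => ?_⟩
    have e : (idem (F' : Set (Points X))).1 a = 1 := by
      rw [← a.alg.idem_univ]
      change a.alg.idem _ = _
      congr 1
      ext p
      simp only [Set.mem_univ, iff_true]
      exact h (by simp)
    simp only [rightMul_of, ← map_sum]
    congr 1
    ext x
    rw [← sum_idem_apply] at e
    simp only [LinearMap.sum_apply, LinearMap.comp_apply, LinearMap.mulLeft_apply, ← map_sum,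
      ← Finset.sum_mul, e, one_mul]

end Fn

/-! ### Super vector spaces -/

theorem zmod_two_univ : (Set.univ : Set (ZMod 2)) = {0, 1} := by
  ext i
  revert i
  exact fun i => ⟨fun _ => (by decide : ∀ i : ZMod 2, i = 0 ∨ i = 1) i, fun _ => trivial⟩


section Parity

variable {M N C D : Type*} [AddCommGroup M] [Module k M] [AddCommGroup N] [Module k N]
  [AddCommGroup C] [Module k C] [AddCommGroup D] [Module k D]

/-- `p` is the family of projections belonging to a decomposition into two components. -/
structure IsProjections (G : ZMod 2 → Submodule k M) (p : ZMod 2 → M →ₗ[k] M) : Prop where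
  mem : ∀ i m, p i m ∈ G i
  of_mem : ∀ i, ∀ m ∈ G i, p i m = m
  add : ∀ m, p 0 m + p 1 m = m

namespace IsProjections

variable {G : ZMod 2 → Submodule k M} {p : ZMod 2 → M →ₗ[k] M}
  {G' : ZMod 2 → Submodule k N} {p' : ZMod 2 → N →ₗ[k] N}

theorem of_mem_ne (h : IsProjections G p) {i j : ZMod 2} (hij : i ≠ j) {m : M} (hm : m ∈ G i) :
    p j m = 0 := by
  have h₁ := h.add m
  have h₂ := h.of_mem i m hm
  fin_cases i <;> fin_cases j
  · exact absurd rfl hij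
  · change p 0 m = m at h₂
    rw [h₂] at h₁
    exact left_eq_add.1 h₁.symm
  · change p 1 m = m at h₂
    rw [h₂] at h₁
    exact right_eq_add.1 h₁.symm
  · exact absurd rfl hij

theorem isInternal (h : IsProjections G p) : DirectSum.IsInternal G := by
  rw [DirectSum.isInternal_submodule_iff_isCompl G (i := 0) (j := 1) (by decide) zmod_two_univ]
  constructor
  · rw [Submodule.disjoint_def]
    intro m h₀ h₁
    rw [← h.of_mem 0 m h₀]
    exact h.of_mem_ne (by decide) h₁
  · rw [codisjoint_iff, Submodule.eq_top_iff']
    intro m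
    rw [← h.add m]
    exact Submodule.add_mem_sup (h.mem 0 m) (h.mem 1 m)

theorem map_comm (h : IsProjections G p) (h' : IsProjections G' p') {α : M →ₗ[k] N}
    (hα : ∀ i, ∀ m ∈ G i, α m ∈ G' i) (i : ZMod 2) (m : M) : p' i (α m) = α (p i m) := by
  conv_lhs => rw [← h.add m]
  rw [map_add, map_add]
  fin_cases i
  · change p' 0 _ + p' 0 _ = α (p 0 m)
    rw [h'.of_mem 0 _ (hα 0 _ (h.mem 0 m)),
      h'.of_mem_ne (i := 1) (by decide) (hα 1 _ (h.mem 1 m)), add_zero]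
  · change p' 1 _ + p' 1 _ = α (p 1 m)
    rw [h'.of_mem 1 _ (hα 1 _ (h.mem 1 m)),
      h'.of_mem_ne (i := 0) (by decide) (hα 0 _ (h.mem 0 m)), zero_add]

end IsProjections

/-- With projections at hand, a subspace or quotient inherits the grading as soon as the projections
restrict or descend to it. -/
theorem exists_isProjections {G : ZMod 2 → Submodule k M} (h : DirectSum.IsInternal G) :
    ∃ p, IsProjections G p := by
  have hc := (DirectSum.isInternal_submodule_iff_isCompl G (i := 0) (j := 1) (by decide) zmod_two_univ).1 h
  have hp : ∀ i : ZMod 2, ∃ p : M →ₗ[k] M, (∀ m, p m ∈ G i) ∧ (∀ m ∈ G i, p m = m) ∧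
      ∀ m ∈ G (i + 1), p m = 0 := by
    intro i
    have hi : IsCompl (G i) (G (i + 1)) := by
      fin_cases i
      · exact hc
      · exact hc.symm
    refine ⟨(G i).projection (G (i + 1)) hi, fun m => ?_, fun m hm => ?_, fun m hm => ?_⟩
    · exact Submodule.projection_apply_mem hi m
    · exact Submodule.projection_apply_left hi ⟨m, hm⟩
    · exact (Submodule.projection_apply_eq_zero_iff hi).2 hm
  choose p h₁ h₂ h₃ using hp
  refine ⟨p, h₁, h₂, fun m => ?_⟩
  obtain ⟨a, ha, b, hb, rfl⟩ := Submodule.mem_sup.1 (hc.sup_eq_top ▸ Submodule.mem_top (x := m))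
  rw [map_add, map_add, h₂ 0 a ha, h₃ 0 b hb, h₃ 1 a ha, h₂ 1 b hb, add_zero, zero_add]

/-- The grading of a tensor product of super vector spaces. -/
abbrev tensorGrading (G : ZMod 2 → Submodule k M) (H : ZMod 2 → Submodule k C) (i : ZMod 2) :
    Submodule k (M ⊗[k] C) :=
  ⨆ j : ZMod 2, Submodule.map₂ (TensorProduct.mk k M C) (G j) (H (i - j))

theorem map_mem_tensorGrading {G : ZMod 2 → Submodule k M} {H : ZMod 2 → Submodule k C}
    {G' : ZMod 2 → Submodule k N} {H' : ZMod 2 → Submodule k D} {α : M →ₗ[k] N} {β : C →ₗ[k] D}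
    (hα : ∀ i, ∀ m ∈ G i, α m ∈ G' i) (hβ : ∀ i, ∀ c ∈ H i, β c ∈ H' i) {i : ZMod 2}
    {t : M ⊗[k] C} (ht : t ∈ tensorGrading G H i) :
    TensorProduct.map α β t ∈ tensorGrading G' H' i := by
  have : tensorGrading G H i ≤ (tensorGrading G' H' i).comap (TensorProduct.map α β) := by
    refine iSup_le fun j => Submodule.map₂_le.2 fun m hm c hc => ?_
    exact Submodule.mem_iSup_of_mem j (Submodule.apply_mem_map₂ _ (hα j m hm) (hβ _ c hc))
  exact this ht

theorem map_mem_map₂ {P : Submodule k N} {Q : Submodule k D} {α : M →ₗ[k] N} {β : C →ₗ[k] D}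
    (hα : ∀ m, α m ∈ P) (hβ : ∀ c, β c ∈ Q) (t : M ⊗[k] C) :
    TensorProduct.map α β t ∈ Submodule.map₂ (TensorProduct.mk k N D) P Q := by
  induction t using TensorProduct.induction_on with
  | zero => simp
  | tmul m c => exact Submodule.apply_mem_map₂ _ (hα m) (hβ c)
  | add x y hx hy => rw [map_add]; exact add_mem hx hy

/-- Contraction with an even linear form preserves the parity. -/
theorem contract_mem {G : ZMod 2 → Submodule k M} {H : ZMod 2 → Submodule k C}
    {f : Module.Dual k C} (hf : ∀ c ∈ H 1, f c = 0) {i : ZMod 2} {t : M ⊗[k] C}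
    (ht : t ∈ tensorGrading G H i) : contract M f t ∈ G i := by
  have : tensorGrading G H i ≤ (G i).comap (contract M f) := by
    refine iSup_le fun j => Submodule.map₂_le.2 fun m hm c hc => ?_
    rw [Submodule.mem_comap, TensorProduct.mk_apply, contract_tmul]
    by_cases h : j = i
    · subst h; exact Submodule.smul_mem _ _ hm
    · have : i - j = 1 := (by decide : ∀ i j : ZMod 2, j ≠ i → i - j = 1) i j h
      rw [hf c (this ▸ hc), zero_smul]
      exact zero_mem _
  exact this ht

end Parity

/-! ### The parity of the super-coalgebra of a formal super functor -/

namespace OStar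

variable (X : SAlgf k ⥤ Type u)

theorem pr_compat (i : ZMod 2) {a b : Pair X} (h : a.Hom b) :
    (OStar.of a ∘ₗ (a.alg.pr i).dualMap) ∘ₗ (dualMap h.hom).toLinearMap
      = OStar.of b ∘ₗ (b.alg.pr i).dualMap := by
  rw [← OStar.of_comp_dualMap h, LinearMap.comp_assoc, LinearMap.comp_assoc]
  congr 1
  ext g x
  exact congrArg g (SAlgf.Hom.lin_pr h.hom i x)

/-- The projection of `O_*(X)` onto its component of degree `i`. -/
def pr (i : ZMod 2) : OStar X →ₗ[k] OStar X :=
  OStar.lift (fun a => OStar.of a ∘ₗ (a.alg.pr i).dualMap) (fun h => pr_compat X i h)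

theorem pr_of (i : ZMod 2) (a : Pair X) (g : Module.Dual k a.alg.carrier) :
    pr X i (OStar.of a g) = OStar.of a (g ∘ₗ a.alg.pr i) :=
  OStar.lift_of (fun a => OStar.of a ∘ₗ (a.alg.pr i).dualMap) (pr_compat X i) a g

variable {X}

theorem of_mem_grading {a : Pair X} {i : ZMod 2} {g : Module.Dual k a.alg.carrier}
    (hg : ∀ x ∈ a.alg.grading (i + 1), g x = 0) : OStar.of a g ∈ OStar.grading X i :=
  Submodule.mem_iSup_of_mem a ⟨g, (Submodule.mem_dualAnnihilator g).2 hg, rfl⟩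

theorem comp_pr_vanish (R : SAlgf k) (g : Module.Dual k R.carrier) (i : ZMod 2) :
    ∀ x ∈ R.grading (i + 1), (g ∘ₗ R.pr i) x = 0 := by
  intro x hx
  rw [LinearMap.comp_apply, R.pr_of_mem_ne hx ((by decide : ∀ i : ZMod 2, i + 1 ≠ i) i), map_zero]

theorem comp_pr_of_vanish (R : SAlgf k) {g : Module.Dual k R.carrier} {i : ZMod 2}
    (hg : ∀ x ∈ R.grading (i + 1), g x = 0) : g ∘ₗ R.pr i = g := by
  ext x
  rw [LinearMap.comp_apply]
  conv_rhs => rw [← R.pr_zero_add_pr_one x, map_add]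
  fin_cases i
  · exact (add_eq_left.2 (hg _ (R.pr_mem 1 x))).symm
  · exact (add_eq_right.2 (hg _ (R.pr_mem 0 x))).symm

theorem grading_le {i : ZMod 2} {S : Submodule k (OStar X)}
    (h : ∀ (a : Pair X) (g : Module.Dual k a.alg.carrier),
      (∀ x ∈ a.alg.grading (i + 1), g x = 0) → OStar.of a g ∈ S) : OStar.grading X i ≤ S := by
  refine iSup_le fun a => ?_
  rintro _ ⟨g, hg, rfl⟩
  exact h a g ((Submodule.mem_dualAnnihilator g).1 hg)

theorem isProjections : IsProjections (OStar.grading X) (OStar.pr X) where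
  mem i c := by
    induction c using OStar.induction with
    | zero => rw [map_zero]; exact zero_mem _
    | add c d hc hd => rw [map_add]; exact add_mem hc hd
    | of a g => rw [pr_of]; exact of_mem_grading (comp_pr_vanish _ g i)
  of_mem i c hc := by
    have : OStar.grading X i ≤ LinearMap.ker (pr X i - LinearMap.id) := grading_le fun a g hg => by
      rw [LinearMap.mem_ker, LinearMap.sub_apply, pr_of, comp_pr_of_vanish _ hg, LinearMap.id_apply,
        sub_self]
    exact sub_eq_zero.1 (this hc)
  add c := by
    induction c using OStar.induction with
    | zero => simp
    | add c d hc hd =>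
      conv_rhs => rw [← hc, ← hd]
      simp only [map_add]
      abel
    | of a g =>
      rw [pr_of, pr_of, ← map_add]
      congr 1
      ext x
      rw [LinearMap.add_apply, LinearMap.comp_apply, LinearMap.comp_apply, ← map_add,
        a.alg.pr_zero_add_pr_one]

theorem dualDistrib_map_map (R : SAlgf k) (l l' : R.carrier →ₗ[k] R.carrier)
    (t : Module.Dual k R.carrier ⊗[k] Module.Dual k R.carrier) (a b : R.carrier) :
    TensorProduct.dualDistrib k R.carrier R.carrier (TensorProduct.map l.dualMap l'.dualMap t)
      (a ⊗ₜ b) = TensorProduct.dualDistrib k R.carrier R.carrier t (l a ⊗ₜ l' b) := by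
  induction t using TensorProduct.induction_on with
  | zero => simp
  | tmul f g => simp
  | add x y hx hy => simp only [map_add, LinearMap.add_apply, hx, hy]

/-- Checked on the pairing with `a ⊗ b`: of the four terms from splitting `a` and `b` into even and
odd parts, the two of total degree `i + 1` are killed by `g`, and the others are the two summands.
-/
theorem dual_comul_eq (R : SAlgf k) {g : Module.Dual k R.carrier} {i : ZMod 2}
    (hg : ∀ x ∈ R.grading (i + 1), g x = 0) :
    Coalgebra.comul (R := k) g
      = TensorProduct.map (R.pr 0).dualMap (R.pr (i - 0)).dualMap (Coalgebra.comul (R := k) g)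
        + TensorProduct.map (R.pr 1).dualMap (R.pr (i - 1)).dualMap
          (Coalgebra.comul (R := k) g) := by
  apply dualDistrib_injective R.carrier R.carrier
  apply TensorProduct.ext'
  intro a b
  rw [map_add, LinearMap.add_apply, dualDistrib_map_map, dualDistrib_map_map, dual_comul_apply,
    dual_comul_apply, dual_comul_apply]
  have h : ∀ j l : ZMod 2, l + j = i + 1 → g (R.pr l b * R.pr j a) = 0 := fun j l h =>
    hg _ (h ▸ R.mul_mem_grading (R.pr_mem l b) (R.pr_mem j a))
  conv_lhs => rw [← R.pr_zero_add_pr_one a, ← R.pr_zero_add_pr_one b]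
  simp only [add_mul, mul_add, map_add]
  fin_cases i
  · rw [h 0 1 (by decide), h 1 0 (by decide)]
    change _ = g (R.pr 0 b * R.pr 0 a) + g (R.pr 1 b * R.pr 1 a)
    abel
  · rw [h 0 0 (by decide), h 1 1 (by decide)]
    change _ = g (R.pr 1 b * R.pr 0 a) + g (R.pr 0 b * R.pr 1 a)
    abel

theorem comul_mem {i : ZMod 2} {c : OStar X} (hc : c ∈ OStar.grading X i) :
    Coalgebra.comul (R := k) c ∈ tensorGrading (OStar.grading X) (OStar.grading X) i := by
  have : OStar.grading X i ≤ (tensorGrading (OStar.grading X) (OStar.grading X) i).comap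
      (Coalgebra.comul (R := k) (A := OStar X)) := grading_le fun a g hg => by
    have hm : ∀ (j : ZMod 2) (g : Module.Dual k a.alg.carrier),
        (OStar.of a ∘ₗ (a.alg.pr j).dualMap) g ∈ OStar.grading X j :=
      fun j g => of_mem_grading (comp_pr_vanish _ g j)
    rw [Submodule.mem_comap, comul_of, dual_comul_eq _ hg, map_add, TensorProduct.map_map,
      TensorProduct.map_map]
    exact add_mem (Submodule.mem_iSup_of_mem 0 (map_mem_map₂ (hm 0) (hm _) _))
      (Submodule.mem_iSup_of_mem 1 (map_mem_map₂ (hm 1) (hm _) _))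
  exact this hc

theorem map_of {X Y : SAlgf k ⥤ Type u} (f : X ⟶ Y) (a : Pair X)
    (g : Module.Dual k a.alg.carrier) : OStar.map f (OStar.of a g) = OStar.of (a.map f) g :=
  OStar.mapLin_of f a g

theorem map_mem {X Y : SAlgf k ⥤ Type u} (f : X ⟶ Y) (i : ZMod 2) :
    ∀ c ∈ OStar.grading X i, OStar.map f c ∈ OStar.grading Y i := by
  have : OStar.grading X i ≤ (OStar.grading Y i).comap (OStar.map f).toLinearMap :=
    grading_le fun a g hg => by
      change OStar.map f (OStar.of a g) ∈ OStar.grading Y i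
      rw [map_of]
      exact of_mem_grading hg
  exact this

end OStar

theorem Fn.toDual_vanish {X : SAlgf k ⥤ Type u} {v : Fn X} (i : ZMod 2)
    (hv : ∀ a, v.1 a ∈ a.alg.grading i) : ∀ c ∈ OStar.grading X (i + 1), toDual v c = 0 := by
  have : OStar.grading X (i + 1) ≤ LinearMap.ker (toDual v) := OStar.grading_le fun a g hg => by
    rw [LinearMap.mem_ker, toDual_of]
    refine hg _ ?_
    rw [(by decide : ∀ i : ZMod 2, i + 1 + 1 = i) i]
    exact hv a
  exact this

/-! ### Comodules -/

section Comodule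

variable {M N C D : Type*} [AddCommGroup M] [Module k M] [AddCommGroup N] [Module k N]
  [AddCommGroup C] [Module k C] [Coalgebra k C] [AddCommGroup D] [Module k D] [Coalgebra k D]
  {ρ : M →ₗ[k] M ⊗[k] C} {σ : N →ₗ[k] N ⊗[k] D} {s : M →ₗ[k] N} {j : C →ₗc[k] D}

theorem assoc_map_rTensor (h : σ ∘ₗ s = TensorProduct.map s j.toLinearMap ∘ₗ ρ)
    {C' D' : Type*} [AddCommGroup C'] [Module k C'] [AddCommGroup D'] [Module k D']
    (i : C' →ₗ[k] D') :
    (TensorProduct.assoc k N D D').toLinearMap ∘ₗ σ.rTensor D' ∘ₗ TensorProduct.map s i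
      = TensorProduct.map s (TensorProduct.map j.toLinearMap i) ∘ₗ
        (TensorProduct.assoc k M C C').toLinearMap ∘ₗ ρ.rTensor C' := by
  rw [LinearMap.rTensor_comp_map, h]
  apply TensorProduct.ext'
  intro m c
  simp only [LinearMap.comp_apply, TensorProduct.map_tmul, LinearMap.rTensor_tmul]
  induction ρ m using TensorProduct.induction_on with
  | zero => simp
  | tmul m c => simp
  | add x y hx hy => simp only [map_add, TensorProduct.add_tmul, hx, hy]

theorem coassoc_naturality (h : σ ∘ₗ s = TensorProduct.map s j.toLinearMap ∘ₗ ρ) :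
    ((TensorProduct.assoc k N D D).toLinearMap ∘ₗ σ.rTensor D ∘ₗ σ) ∘ₗ s
      = TensorProduct.map s (TensorProduct.map j.toLinearMap j.toLinearMap) ∘ₗ
        (TensorProduct.assoc k M C C).toLinearMap ∘ₗ ρ.rTensor C ∘ₗ ρ := by
  have := congrArg (· ∘ₗ ρ) (assoc_map_rTensor h j.toLinearMap)
  simp only [LinearMap.comp_assoc] at this ⊢
  rw [h]
  exact this

theorem comul_naturality (h : σ ∘ₗ s = TensorProduct.map s j.toLinearMap ∘ₗ ρ) :
    ((Coalgebra.comul (R := k) (A := D)).lTensor N ∘ₗ σ) ∘ₗ s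
      = TensorProduct.map s (TensorProduct.map j.toLinearMap j.toLinearMap) ∘ₗ
        (Coalgebra.comul (R := k) (A := C)).lTensor M ∘ₗ ρ := by
  rw [LinearMap.comp_assoc, h, ← LinearMap.comp_assoc, LinearMap.lTensor_comp_map,
    ← LinearMap.comp_assoc, LinearMap.map_comp_lTensor, j.map_comp_comul]

theorem counit_naturality (h : σ ∘ₗ s = TensorProduct.map s j.toLinearMap ∘ₗ ρ) :
    ((Coalgebra.counit (R := k) (A := D)).lTensor N ∘ₗ σ) ∘ₗ s
      = s.rTensor k ∘ₗ (Coalgebra.counit (R := k) (A := C)).lTensor M ∘ₗ ρ := by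
  rw [LinearMap.comp_assoc, h, ← LinearMap.comp_assoc, LinearMap.lTensor_comp_map,
    ← LinearMap.comp_assoc, LinearMap.rTensor_comp_lTensor, j.counit_comp]

theorem mk_naturality (s : M →ₗ[k] N) :
    (TensorProduct.mk k N k).flip 1 ∘ₗ s = s.rTensor k ∘ₗ (TensorProduct.mk k M k).flip 1 := rfl

/-- A pair `(s, j)` intertwining two coactions transports the comodule axioms forward along
surjections and, in the companion lemmas, back along injections. Push-forwards and cokernels use the
first, the summands `M_y` the second. -/
theorem coassoc_of_surjective (h : σ ∘ₗ s = TensorProduct.map s j.toLinearMap ∘ₗ ρ)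
    (hs : Function.Surjective s)
    (hρ : (TensorProduct.assoc k M C C).toLinearMap ∘ₗ ρ.rTensor C ∘ₗ ρ
      = (Coalgebra.comul (R := k) (A := C)).lTensor M ∘ₗ ρ) :
    (TensorProduct.assoc k N D D).toLinearMap ∘ₗ σ.rTensor D ∘ₗ σ
      = (Coalgebra.comul (R := k) (A := D)).lTensor N ∘ₗ σ := by
  rw [← LinearMap.cancel_right hs, coassoc_naturality h, comul_naturality h, hρ]

theorem counit_of_surjective (h : σ ∘ₗ s = TensorProduct.map s j.toLinearMap ∘ₗ ρ)
    (hs : Function.Surjective s)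
    (hρ : (Coalgebra.counit (R := k) (A := C)).lTensor M ∘ₗ ρ = (TensorProduct.mk k M k).flip 1) :
    (Coalgebra.counit (R := k) (A := D)).lTensor N ∘ₗ σ = (TensorProduct.mk k N k).flip 1 := by
  rw [← LinearMap.cancel_right hs, counit_naturality h, mk_naturality, hρ]

theorem coassoc_of_injective (h : σ ∘ₗ s = TensorProduct.map s j.toLinearMap ∘ₗ ρ)
    (hs : Function.Injective s) (hj : Function.Injective j)
    (hσ : (TensorProduct.assoc k N D D).toLinearMap ∘ₗ σ.rTensor D ∘ₗ σ
      = (Coalgebra.comul (R := k) (A := D)).lTensor N ∘ₗ σ) :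
    (TensorProduct.assoc k M C C).toLinearMap ∘ₗ ρ.rTensor C ∘ₗ ρ
      = (Coalgebra.comul (R := k) (A := C)).lTensor M ∘ₗ ρ := by
  have hi : Function.Injective
      (TensorProduct.map s (TensorProduct.map j.toLinearMap j.toLinearMap)) :=
    TensorProduct.map_injective_of_flat_flat _ _ hs
      (TensorProduct.map_injective_of_flat_flat _ _ hj hj)
  rw [← LinearMap.cancel_left hi, ← coassoc_naturality h, ← comul_naturality h, hσ]

theorem counit_of_injective (h : σ ∘ₗ s = TensorProduct.map s j.toLinearMap ∘ₗ ρ)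
    (hs : Function.Injective s)
    (hσ : (Coalgebra.counit (R := k) (A := D)).lTensor N ∘ₗ σ = (TensorProduct.mk k N k).flip 1) :
    (Coalgebra.counit (R := k) (A := C)).lTensor M ∘ₗ ρ = (TensorProduct.mk k M k).flip 1 := by
  have hi : Function.Injective (s.rTensor k) :=
    Module.Flat.rTensor_preserves_injective_linearMap _ hs
  rw [← LinearMap.cancel_left hi, ← counit_naturality h, ← mk_naturality, hσ]

end Comodule

/-! ### The irreducible components -/

namespace SAlgf

variable (R : SAlgf k) (S : Set (SSpec R))

/-- The ideal generated by the idempotent belonging to a set of points. -/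
abbrev cornerSubmodule : Submodule k R.carrier :=
  LinearMap.ker (LinearMap.mulLeft k (R.idem S) - LinearMap.id)

variable {R S} in
theorem mem_corner {v : R.carrier} : v ∈ R.cornerSubmodule S ↔ R.idem S * v = v := by
  rw [LinearMap.mem_ker, LinearMap.sub_apply, sub_eq_zero]
  rfl

theorem idem_mul_mem_corner (v : R.carrier) : R.idem S * v ∈ R.cornerSubmodule S := by
  rw [mem_corner, ← mul_assoc, idem_mul_self]

instance : Ring (R.cornerSubmodule S) :=
  { (inferInstance : AddCommGroup (R.cornerSubmodule S)) with
    mul := fun v w => ⟨v.1 * w.1, mem_corner.2 (by rw [← mul_assoc, mem_corner.1 v.2])⟩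
    one := ⟨R.idem S, mem_corner.2 (R.idem_mul_self S)⟩
    mul_assoc := fun a b c => Subtype.ext (mul_assoc a.1 b.1 c.1)
    one_mul := fun a => Subtype.ext (mem_corner.1 a.2)
    mul_one := fun a => Subtype.ext ((R.idem_comm S a.1).symm.trans (mem_corner.1 a.2))
    left_distrib := fun a b c => Subtype.ext (mul_add a.1 b.1 c.1)
    right_distrib := fun a b c => Subtype.ext (add_mul a.1 b.1 c.1)
    zero_mul := fun a => Subtype.ext (zero_mul a.1)
    mul_zero := fun a => Subtype.ext (mul_zero a.1) }

instance : Algebra k (R.cornerSubmodule S) :=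
  Algebra.ofModule (fun c a b => Subtype.ext (smul_mul_assoc c a.1 b.1))
    (fun c a b => Subtype.ext (mul_smul_comm c a.1 b.1))

/-- The grading of the corner. -/
def cornerGrading (i : ZMod 2) : Submodule k (R.cornerSubmodule S) :=
  (R.grading i).comap (R.cornerSubmodule S).subtype

theorem pr_idem_mul (i : ZMod 2) (v : R.carrier) :
    R.pr i (R.idem S * v) = R.idem S * R.pr i v := by
  have h : ∀ j, ∀ w ∈ R.grading j, R.idem S * w ∈ R.grading j := fun j w hw => by
    have := R.mul_mem_grading (R.idem_mem S) hw
    rwa [zero_add] at this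
  conv_lhs => rw [← R.pr_zero_add_pr_one v, mul_add, map_add]
  fin_cases i
  · change R.pr 0 _ + R.pr 0 _ = R.idem S * R.pr 0 v
    rw [R.pr_of_mem (h 0 _ (R.pr_mem 0 v)), R.pr_of_mem_ne (h 1 _ (R.pr_mem 1 v)) (by decide),
      add_zero]
  · change R.pr 1 _ + R.pr 1 _ = R.idem S * R.pr 1 v
    rw [R.pr_of_mem (h 1 _ (R.pr_mem 1 v)), R.pr_of_mem_ne (h 0 _ (R.pr_mem 0 v)) (by decide),
      zero_add]

/-- The projections of the corner onto its components. -/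
def cornerPr (i : ZMod 2) : R.cornerSubmodule S →ₗ[k] R.cornerSubmodule S :=
  (R.pr i).restrict fun v hv => mem_corner.2 (by
    rw [← pr_idem_mul, mem_corner.1 hv])

theorem corner_isProjections : IsProjections (R.cornerGrading S) (R.cornerPr S) where
  mem i m := R.pr_mem i m.1
  of_mem _ _ hm := Subtype.ext (R.pr_of_mem hm)
  add m := Subtype.ext (R.pr_zero_add_pr_one m.1)

instance : GradedAlgebra (R.cornerGrading S) where
  one_mem := R.idem_mem S
  mul_mem _ _ _ _ hv hw := R.mul_mem_grading hv hw
  toDecomposition := (R.corner_isProjections S).isInternal.chooseDecomposition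

/-- The quotient of a superalgebra that belongs to an open and closed set of points, realized as
the ideal generated by an idempotent. -/
def corner : SAlgf k where
  carrier := R.cornerSubmodule S
  grading := R.cornerGrading S
  finite := inferInstanceAs (Module.Finite k (R.cornerSubmodule S))
  even_central a ha b := Subtype.ext (R.even_central a.1 ha b.1)
  odd_sq a ha := Subtype.ext (R.odd_sq a.1 ha)

/-- The quotient map onto the corner. -/
def toCorner : R ⟶ R.corner S :=
  { AlgHom.ofLinearMap
      ((LinearMap.mulLeft k (R.idem S)).codRestrict (R.cornerSubmodule S) (R.idem_mul_mem_corner S))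
      (Subtype.ext (mul_one _)) (fun v w => Subtype.ext (by
        change R.idem S * (v * w) = R.idem S * v * (R.idem S * w)
        rw [mul_assoc, ← mul_assoc v, ← R.idem_comm S v, mul_assoc (R.idem S) v,
          ← mul_assoc (R.idem S) (R.idem S), R.idem_mul_self])) with
    map_mem := fun {i v} hv => by
      have := R.mul_mem_grading (R.idem_mem S) hv
      rw [zero_add] at this
      exact this }

/-- The inclusion of the corner. -/
def cornerVal : (R.corner S).carrier →ₗ[k] R.carrier := (R.cornerSubmodule S).subtype

theorem comap_toCorner_mem (p : SSpec (R.corner S)) : SSpec.comap (R.toCorner S) p ∈ S := by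
  by_contra h
  rw [← idem_mem_iff, SSpec.mem_comap] at h
  refine p.one_notMem ?_
  have : Hom.lin (R.toCorner S) (R.idem S) = 1 := Subtype.ext (R.idem_mul_self S)
  rwa [this] at h

variable {R}

/-- The map of corners induced by a homomorphism. -/
def cornerMap {R' : SAlgf k} (h : R ⟶ R') : R.corner S ⟶ R'.corner (SSpec.comap h ⁻¹' S) :=
  { AlgHom.ofLinearMap
      ((Hom.lin h ∘ₗ R.cornerVal S).codRestrict (R'.cornerSubmodule (SSpec.comap h ⁻¹' S))
        (fun v => mem_corner.2 (by
          rw [← Hom.lin_idem, LinearMap.comp_apply, ← Hom.lin_mul]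
          exact congrArg _ (mem_corner.1 v.2))))
      (Subtype.ext (Hom.lin_idem h S)) (fun v w => Subtype.ext (Hom.lin_mul h v.1 w.1)) with
    map_mem := fun {i v} hv => Hom.lin_mem h hv }

theorem toCorner_comp_cornerMap {R' : SAlgf k} (h : R ⟶ R') :
    R.toCorner S ≫ cornerMap S h = h ≫ R'.toCorner (SSpec.comap h ⁻¹' S) := by
  apply GradedAlgHom.ext
  intro v
  apply Subtype.ext
  change Hom.lin h (R.idem S * v) = R'.idem (SSpec.comap h ⁻¹' S) * Hom.lin h v
  rw [Hom.lin_mul, Hom.lin_idem]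

end SAlgf

/-! ### The super-coalgebra of an irreducible component as a direct summand. -/

section Component

variable {X Y : SAlgf k ⥤ Type u} (x : Points X)

/-- The set of points of `SSpec R` over `x`, for a pair `(R, a)`. -/
abbrev fibre (a : Pair X) : Set (SSpec a.alg) := {p | Points.mk a.elt p ∈ ({x} : Set (Points X))}

/-- The restriction of a pair to the irreducible component at `x`. -/
def cornerPair (a : Pair X) : Pair (component X x).toFunctor :=
  ⟨a.alg.corner (fibre x a), ⟨X.map (a.alg.toCorner (fibre x a)) a.elt, fun p => by
    rw [Points.mk_map]
    exact a.alg.comap_toCorner_mem (fibre x a) p⟩⟩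

/-- The inclusion of the superalgebra of the restriction of a pair. -/
def cornerPairVal (a : Pair X) : (cornerPair x a).alg.carrier →ₗ[k] a.alg.carrier :=
  a.alg.cornerVal (fibre x a)

/-- The map from a pair to its restriction to an irreducible component. -/
def toCornerPair (a : Pair X) : a.Hom ((cornerPair x a).map (component X x).ι) :=
  ⟨a.alg.toCorner (fibre x a), rfl⟩

theorem Pair.Hom.preimage_fibre {a b : Pair X} (h : a.Hom b) :
    SSpec.comap h.hom ⁻¹' fibre x a = fibre x b := by
  ext p
  change Points.mk a.elt (SSpec.comap h.hom p) ∈ ({x} : Set (Points X)) ↔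
    Points.mk b.elt p ∈ ({x} : Set (Points X))
  rw [← Points.mk_map, h.map_elt]

theorem exists_cornerPairMap {a b : Pair X} (h : a.Hom b) :
    ∃ h' : (cornerPair x a).Hom (cornerPair x b),
      cornerPairVal x b ∘ₗ SAlgf.Hom.lin h'.hom
        = SAlgf.Hom.lin h.hom ∘ₗ cornerPairVal x a := by
  -- The fibre over `b` equals the preimage only propositionally; stating the claim for a variable
  -- `T` lets the equality be substituted instead of transporting along types of corners.
  have key : ∀ (T : Set (SSpec b.alg)) (_ : SSpec.comap h.hom ⁻¹' fibre x a = T),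
      ∃ h' : a.alg.corner (fibre x a) ⟶ b.alg.corner T,
        a.alg.toCorner (fibre x a) ≫ h' = h.hom ≫ b.alg.toCorner T ∧
        b.alg.cornerVal T ∘ₗ SAlgf.Hom.lin h' = SAlgf.Hom.lin h.hom ∘ₗ a.alg.cornerVal _ := by
    rintro T rfl
    exact ⟨SAlgf.cornerMap _ h.hom, SAlgf.toCorner_comp_cornerMap _ h.hom, rfl⟩
  obtain ⟨h', e, e'⟩ := key _ (h.preimage_fibre x)
  refine ⟨⟨h', Subtype.ext ?_⟩, e'⟩
  change X.map h' (X.map (a.alg.toCorner (fibre x a)) a.elt)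
    = X.map (b.alg.toCorner (fibre x b)) b.elt
  rw [← h.map_elt, ← Functor.map_comp_apply, ← Functor.map_comp_apply, e]

/-- The inclusion of the ideal `eR` in `R` need not preserve `1`, so its transpose is taken only as
a linear map; it still commutes with the transition maps. -/
theorem componentRetraction_compat {a b : Pair X} (h : a.Hom b) :
    (OStar.of (cornerPair x a) ∘ₗ (cornerPairVal x a).dualMap) ∘ₗ
        (dualMap h.hom).toLinearMap
      = OStar.of (cornerPair x b) ∘ₗ (cornerPairVal x b).dualMap := by
  obtain ⟨h', e⟩ := exists_cornerPairMap x h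
  refine LinearMap.ext fun g => Eq.trans (congrArg (OStar.of (cornerPair x a)) ?_)
    (LinearMap.congr_fun (OStar.of_comp_dualMap h') (g ∘ₗ cornerPairVal x b))
  exact LinearMap.ext fun v => congrArg g (LinearMap.congr_fun e v).symm

/-- The projection of `O_*(X)` onto the super-coalgebra of the irreducible component at `x`. -/
def componentRetraction : OStar X →ₗ[k] OStar (component X x).toFunctor :=
  OStar.lift (fun a => OStar.of (cornerPair x a) ∘ₗ (cornerPairVal x a).dualMap)
    (fun h => componentRetraction_compat x h)

theorem componentRetraction_of (a : Pair X) (g : Module.Dual k a.alg.carrier) :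
    componentRetraction x (OStar.of a g)
      = OStar.of (cornerPair x a) (g ∘ₗ cornerPairVal x a) :=
  OStar.lift_of (fun a => OStar.of (cornerPair x a) ∘ₗ (cornerPairVal x a).dualMap)
    (fun h => componentRetraction_compat x h) a g

theorem componentRetraction_mem (i : ZMod 2) :
    ∀ c ∈ OStar.grading X i,
      componentRetraction x c ∈ OStar.grading (component X x).toFunctor i := by
  have : OStar.grading X i
      ≤ (OStar.grading (component X x).toFunctor i).comap (componentRetraction x) :=
    OStar.grading_le fun a g hg => by
      rw [Submodule.mem_comap, componentRetraction_of]
      exact OStar.of_mem_grading fun v hv => hg _ hv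
  exact this

/-- The inclusion of the super-coalgebra of the irreducible component at `x`. -/
abbrev componentInclusion : OStar (component X x).toFunctor →ₗc[k] OStar X :=
  OStar.map (component X x).ι

/-- For `a ∈ X_x(R)` all of `SSpec R` lies over `x`, so the idempotent is `1` and passing to the
corner changes nothing. -/
theorem componentRetraction_componentInclusion (c : OStar (component X x).toFunctor) :
    componentRetraction x (componentInclusion x c) = c := by
  refine LinearMap.congr_fun (f := componentRetraction x ∘ₗ (componentInclusion x).toLinearMap)
    (g := LinearMap.id) (OStar.hom_ext fun a => LinearMap.ext fun g => ?_) c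
  change componentRetraction x (componentInclusion x (OStar.of a g)) = OStar.of a g
  rw [OStar.map_of, componentRetraction_of]
  let a' : Pair X := a.map (component X x).ι
  have hu : fibre x a' = Set.univ := Set.eq_univ_of_forall fun p => a.elt.2 p
  let h : a.Hom (cornerPair x a') := ⟨a'.alg.toCorner (fibre x a'), Subtype.ext rfl⟩
  have e := LinearMap.congr_fun (OStar.of_comp_dualMap h) (g ∘ₗ cornerPairVal x a')
  refine e.symm.trans ?_
  change OStar.of a ((g ∘ₗ cornerPairVal x a') ∘ₗ SAlgf.Hom.lin _) = _
  congr 1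
  ext v
  change g (a'.alg.idem (fibre x a') * v) = g v
  rw [hu, a'.alg.idem_univ, one_mul]

theorem componentInclusion_injective : Function.Injective (componentInclusion x) :=
  Function.LeftInverse.injective (componentRetraction_componentInclusion x)

/-- The composite `R → eR → R` is multiplication by `e`; transpose it. Together with the retraction
property this exhibits `O_*(X_x)` as the image of the projector given by `e_x`. -/
theorem componentInclusion_componentRetraction (c : OStar X) :
    componentInclusion x (componentRetraction x c) = rightMul (Fn.toDual (Fn.idem {x})) c := by
  refine LinearMap.congr_fun (f := (componentInclusion x).toLinearMap ∘ₗ componentRetraction x)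
    (OStar.hom_ext fun a => LinearMap.ext fun g => ?_) c
  change componentInclusion x (componentRetraction x (OStar.of a g)) = rightMul _ (OStar.of a g)
  rw [componentRetraction_of, OStar.map_of, Fn.rightMul_of]
  exact (LinearMap.congr_fun (OStar.of_comp_dualMap (toCornerPair x a))
    (g ∘ₗ cornerPairVal x a)).symm

theorem OStar.map_comp {X Y Z : SAlgf k ⥤ Type u} (f : X ⟶ Y) (g : Y ⟶ Z) (c : OStar X) :
    OStar.map (f ≫ g) c = OStar.map g (OStar.map f c) := by
  refine LinearMap.congr_fun (f := (OStar.map (f ≫ g)).toLinearMap)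
    (g := (OStar.map g).toLinearMap ∘ₗ (OStar.map f).toLinearMap)
    (OStar.hom_ext fun a => LinearMap.ext fun c => ?_) c
  change OStar.map (f ≫ g) (OStar.of a c) = OStar.map g (OStar.map f (OStar.of a c))
  rw [OStar.map_of, OStar.map_of, OStar.map_of]
  rfl

theorem componentInclusion_map (f : X ⟶ Y) (c : OStar (component X x).toFunctor) :
    OStar.map f (componentInclusion x c)
      = componentInclusion (Points.map f x) (OStar.map (componentMap f x) c) := by
  rw [← OStar.map_comp, ← OStar.map_comp]
  rfl

end Component

/-! ### Functoriality of the cotensor product -/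

section Cotensor

variable {C D C' D' : Type w} [AddCommGroup C] [Module k C] [Coalgebra k C] [AddCommGroup D]
  [Module k D] [Coalgebra k D] [AddCommGroup C'] [Module k C'] [Coalgebra k C'] [AddCommGroup D']
  [Module k D'] [Coalgebra k D'] {𝒟 : ZMod 2 → Submodule k D} {𝒟' : ZMod 2 → Submodule k D'}
  {φ : C →ₗc[k] D} {φ' : C' →ₗc[k] D'} {i : C' →ₗc[k] C} {j : D' →ₗc[k] D}

theorem mem_cotensor {M : SuperComodule 𝒟} {z : M.carrier ⊗[k] C} :
    z ∈ cotensor φ M ↔ TensorProduct.assoc k M.carrier D C (M.coact.rTensor C z)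
      = (leftCoact φ).lTensor M.carrier z := by
  rw [cotensor, LinearMap.mem_ker, LinearMap.sub_apply, sub_eq_zero]
  rfl

theorem leftCoact_naturality (h : ∀ c, φ (i c) = j (φ' c)) :
    leftCoact φ ∘ₗ i.toLinearMap
      = TensorProduct.map j.toLinearMap i.toLinearMap ∘ₗ leftCoact φ' := by
  have h' : φ.toLinearMap ∘ₗ i.toLinearMap = j.toLinearMap ∘ₗ φ'.toLinearMap := LinearMap.ext h
  rw [leftCoact, leftCoact, LinearMap.comp_assoc, ← i.map_comp_comul, ← LinearMap.comp_assoc,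
    ← LinearMap.comp_assoc, LinearMap.rTensor_comp_map, LinearMap.map_comp_rTensor, h']

/-- Both sides of the cotensor condition are transported by `s ⊗ j ⊗ i`. Over a field this map is
injective when its three factors are, so membership is then reflected as well as preserved. -/
theorem cotensor_naturality (h : ∀ c, φ (i c) = j (φ' c)) {M : SuperComodule 𝒟}
    {M' : SuperComodule 𝒟'} {s : M'.carrier →ₗ[k] M.carrier}
    (hs : M.coact ∘ₗ s = TensorProduct.map s j.toLinearMap ∘ₗ M'.coact) (z : M'.carrier ⊗[k] C') :
    TensorProduct.map s i.toLinearMap z ∈ cotensor φ M ↔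
      TensorProduct.map s (TensorProduct.map j.toLinearMap i.toLinearMap)
        (TensorProduct.assoc k M'.carrier D' C' (M'.coact.rTensor C' z))
      = TensorProduct.map s (TensorProduct.map j.toLinearMap i.toLinearMap)
        ((leftCoact φ').lTensor M'.carrier z) := by
  have h₁ := LinearMap.congr_fun (assoc_map_rTensor hs i.toLinearMap) z
  have h₂ : (leftCoact φ).lTensor M.carrier ∘ₗ TensorProduct.map s i.toLinearMap
      = TensorProduct.map s (TensorProduct.map j.toLinearMap i.toLinearMap) ∘ₗ
        (leftCoact φ').lTensor M'.carrier := by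
    rw [LinearMap.lTensor_comp_map, LinearMap.map_comp_lTensor, leftCoact_naturality h]
  rw [mem_cotensor]
  exact (Eq.congr h₁ (LinearMap.congr_fun h₂ z))

theorem map_mem_cotensor (h : ∀ c, φ (i c) = j (φ' c)) {M : SuperComodule 𝒟}
    {M' : SuperComodule 𝒟'} {s : M'.carrier →ₗ[k] M.carrier}
    (hs : M.coact ∘ₗ s = TensorProduct.map s j.toLinearMap ∘ₗ M'.coact) {z : M'.carrier ⊗[k] C'}
    (hz : z ∈ cotensor φ' M') : TensorProduct.map s i.toLinearMap z ∈ cotensor φ M :=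
  (cotensor_naturality h hs z).2 (congrArg _ (mem_cotensor.1 hz))

theorem mem_cotensor_of_map_mem (h : ∀ c, φ (i c) = j (φ' c)) {M : SuperComodule 𝒟}
    {M' : SuperComodule 𝒟'} {s : M'.carrier →ₗ[k] M.carrier}
    (hs : M.coact ∘ₗ s = TensorProduct.map s j.toLinearMap ∘ₗ M'.coact)
    (hs' : Function.Injective s) (hi : Function.Injective i) (hj : Function.Injective j)
    {z : M'.carrier ⊗[k] C'} (hz : TensorProduct.map s i.toLinearMap z ∈ cotensor φ M) :
    z ∈ cotensor φ' M' :=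
  mem_cotensor.2 (TensorProduct.map_injective_of_flat_flat s _ hs'
    (TensorProduct.map_injective_of_flat_flat j.toLinearMap i.toLinearMap hj hi)
    ((cotensor_naturality h hs z).1 hz))

theorem leftCoact_rightMul (f : Module.Dual k C) :
    leftCoact φ ∘ₗ rightMul f = (rightMul f).lTensor D ∘ₗ leftCoact φ := by
  refine LinearMap.ext fun c => ?_
  rw [leftCoact, LinearMap.comp_apply, LinearMap.comp_apply, comul_rightMul, ← LinearMap.comp_apply,
    LinearMap.rTensor_comp_lTensor, ← LinearMap.lTensor_comp_rTensor]
  rfl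

/-- The cotensor condition involves only the left coaction on `C`, with which multiplication from
the right commutes. -/
theorem lTensor_rightMul_mem_cotensor (f : Module.Dual k C) {M : SuperComodule 𝒟}
    {z : M.carrier ⊗[k] C} (hz : z ∈ cotensor φ M) :
    (rightMul f).lTensor M.carrier z ∈ cotensor φ M := by
  rw [mem_cotensor] at hz ⊢
  have h₁ : (TensorProduct.assoc k M.carrier D C).toLinearMap ∘ₗ M.coact.rTensor C ∘ₗ
      (rightMul f).lTensor M.carrier = ((rightMul f).lTensor D).lTensor M.carrier ∘ₗ
        (TensorProduct.assoc k M.carrier D C).toLinearMap ∘ₗ M.coact.rTensor C := by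
    rw [LinearMap.rTensor_comp_lTensor, ← LinearMap.lTensor_comp_rTensor, ← LinearMap.comp_assoc,
      ← LinearMap.comp_assoc]
    congr 1
    ext m d c
    rfl
  refine (LinearMap.congr_fun h₁ z).trans ?_
  rw [← LinearMap.comp_apply (LinearMap.lTensor _ _) (LinearMap.lTensor _ _),
    ← LinearMap.lTensor_comp, leftCoact_rightMul, LinearMap.lTensor_comp]
  exact congrArg _ hz

/-- A vanishing composite stays zero under the functor, so exactness reduces to lifting elements of
the kernel. -/
theorem cotensorMap_exact {L M N : SuperComodule 𝒟} {α : L.Hom M} {β : M.Hom N}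
    (h₀ : ∀ l, β.toLin (α.toLin l) = 0)
    (h : ∀ z ∈ cotensor φ M, β.toLin.rTensor C z = 0 →
      ∃ w ∈ cotensor φ L, α.toLin.rTensor C w = z) :
    Function.Exact (cotensorMap φ α) (cotensorMap φ β) := by
  rintro ⟨z, hz⟩
  constructor
  · intro e
    obtain ⟨w, hw, rfl⟩ := h z hz (congrArg Subtype.val e)
    exact ⟨⟨w, hw⟩, rfl⟩
  · rintro ⟨⟨w, hw⟩, e⟩
    apply Subtype.ext
    change β.toLin.rTensor C z = 0
    rw [← show α.toLin.rTensor C w = z from congrArg Subtype.val e, ← LinearMap.rTensor_comp_apply,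
      show β.toLin ∘ₗ α.toLin = 0 from LinearMap.ext h₀, LinearMap.rTensor_zero,
      LinearMap.zero_apply]

theorem exists_of_cotensorMap_exact {L M N : SuperComodule 𝒟} {α : L.Hom M} {β : M.Hom N}
    (h : Function.Exact (cotensorMap φ α) (cotensorMap φ β)) {z : M.carrier ⊗[k] C}
    (hz : z ∈ cotensor φ M) (e : β.toLin.rTensor C z = 0) :
    ∃ w ∈ cotensor φ L, α.toLin.rTensor C w = z := by
  obtain ⟨⟨w, hw⟩, e'⟩ := (h ⟨z, hz⟩).1 (Subtype.ext e)
  exact ⟨w, hw, congrArg Subtype.val e'⟩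

end Cotensor

/-! ### Push-forward of comodules -/

section Push

variable {C D : Type w} [AddCommGroup C] [Module k C] [Coalgebra k C] [AddCommGroup D]
  [Module k D] [Coalgebra k D] {𝒞 : ZMod 2 → Submodule k C} {𝒟 : ZMod 2 → Submodule k D}

namespace SuperComodule

theorem map_id_comp_coact (j : C →ₗc[k] D) (M : SuperComodule 𝒞) :
    (j.toLinearMap.lTensor M.carrier ∘ₗ M.coact) ∘ₗ LinearMap.id
      = TensorProduct.map LinearMap.id j.toLinearMap ∘ₗ M.coact := rfl

/-- The super-comodule over `D` obtained from one over `C` by means of an even homomorphism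
`C → D`. -/
def push (j : C →ₗc[k] D) (hj : ∀ i, ∀ c ∈ 𝒞 i, j c ∈ 𝒟 i) (M : SuperComodule 𝒞) :
    SuperComodule 𝒟 where
  carrier := M.carrier
  grading := M.grading
  isInternal := M.isInternal
  coact := j.toLinearMap.lTensor M.carrier ∘ₗ M.coact
  coassoc := coassoc_of_surjective (map_id_comp_coact j M) Function.surjective_id M.coassoc
  counit_coact := counit_of_surjective (map_id_comp_coact j M) Function.surjective_id M.counit_coact
  coact_even i m hm :=
    map_mem_tensorGrading (α := LinearMap.id) (fun _ _ h => h) hj (M.coact_even i m hm)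

/-- The push-forward of a morphism of super-comodules. -/
def Hom.push (j : C →ₗc[k] D) (hj : ∀ i, ∀ c ∈ 𝒞 i, j c ∈ 𝒟 i) {M N : SuperComodule 𝒞}
    (α : M.Hom N) : (M.push j hj).Hom (N.push j hj) where
  toLin := α.toLin
  even := α.even
  coact_comp := by
    change (j.toLinearMap.lTensor N.carrier ∘ₗ N.coact) ∘ₗ α.toLin
      = α.toLin.rTensor D ∘ₗ j.toLinearMap.lTensor M.carrier ∘ₗ M.coact
    rw [LinearMap.comp_assoc, α.coact_comp, ← LinearMap.comp_assoc, ← LinearMap.comp_assoc,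
      LinearMap.lTensor_comp_rTensor, LinearMap.rTensor_comp_lTensor]

section

variable (j : C →ₗc[k] D) (hj : ∀ i, ∀ c ∈ 𝒞 i, j c ∈ 𝒟 i) (M : SuperComodule 𝒞)

/-- The identity map from a super-comodule to its push-forward. -/
def toPush : M.carrier →ₗ[k] (M.push j hj).carrier := LinearMap.id

/-- The identity map from the push-forward of a super-comodule. -/
def ofPush : (M.push j hj).carrier →ₗ[k] M.carrier := LinearMap.id

theorem ofPush_comp_toPush : M.ofPush j hj ∘ₗ M.toPush j hj = LinearMap.id := rfl

theorem toPush_comp_ofPush : M.toPush j hj ∘ₗ M.ofPush j hj = LinearMap.id := rfl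

theorem toPush_injective : Function.Injective (M.toPush j hj) := Function.injective_id

theorem toPush_naturality :
    (M.push j hj).coact ∘ₗ M.toPush j hj
      = TensorProduct.map (M.toPush j hj) j.toLinearMap ∘ₗ M.coact := rfl

variable {M} in
theorem Hom.push_comp_toPush {N : SuperComodule 𝒞} (α : M.Hom N) :
    (α.push j hj).toLin ∘ₗ M.toPush j hj = N.toPush j hj ∘ₗ α.toLin := rfl

variable {M} in
theorem Hom.comp_ofPush {N : SuperComodule 𝒞} (α : M.Hom N) :
    α.toLin ∘ₗ M.ofPush j hj = N.ofPush j hj ∘ₗ (α.push j hj).toLin := rfl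

end

end SuperComodule

end Push

/-! ### The action of functions on comodules -/

namespace SuperComodule

variable {Y : SAlgf k ⥤ Type u} (M : Supermodule Y)

/-- The action of a function on `Y` on a `Y`-supermodule. -/
def act (v : Fn Y) : M.carrier →ₗ[k] M.carrier := contract M.carrier (Fn.toDual v) ∘ₗ M.coact

/-- The order of the factors is reversed: a right comodule gives a right module over the functions.
-/
theorem act_act (v w : Fn Y) (m : M.carrier) : M.act v (M.act w m) = M.act (w * v) m := by
  rw [act, act, act, LinearMap.comp_apply, LinearMap.comp_apply, contract_contract M.coassoc,
    Fn.toDual_comp_rightMul]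
  rfl

theorem act_one (m : M.carrier) : M.act 1 m = m := by
  rw [act, LinearMap.comp_apply, Fn.toDual_one, contract, LinearMap.comp_apply]
  have := LinearMap.congr_fun M.counit_coact m
  rw [LinearMap.comp_apply] at this
  rw [this]
  simp

theorem act_add (v w : Fn Y) (m : M.carrier) : M.act (v + w) m = M.act v m + M.act w m := by
  obtain ⟨F, hF⟩ := contract_linear (M.coact m)
  simp only [act, LinearMap.comp_apply, ← hF, map_add]

theorem act_smul (c : k) (v : Fn Y) (m : M.carrier) : M.act (c • v) m = c • M.act v m := by
  obtain ⟨F, hF⟩ := contract_linear (M.coact m)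
  simp only [act, LinearMap.comp_apply, ← hF, map_smul]

variable {M} in
theorem Hom.map_act {N : Supermodule Y} (α : M.Hom N) (v : Fn Y) (m : M.carrier) :
    α.toLin (M.act v m) = N.act v (α.toLin m) := by
  have h := LinearMap.congr_fun α.coact_comp m
  rw [LinearMap.comp_apply] at h
  rw [act, act, LinearMap.comp_apply, LinearMap.comp_apply, h, LinearMap.comp_apply,
    contract_rTensor]

theorem act_idem_idem (F : Set (Points Y)) (m : M.carrier) :
    M.act (Fn.idem F) (M.act (Fn.idem F) m) = M.act (Fn.idem F) m := by
  rw [act_act, Fn.idem_mul_self]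

theorem act_idem_mem (F : Set (Points Y)) {i : ZMod 2} {m : M.carrier} (hm : m ∈ M.grading i) :
    M.act (Fn.idem F) m ∈ M.grading i :=
  contract_mem (Fn.toDual_vanish 0 fun a => a.alg.idem_mem _) (M.coact_even i m hm)

/-! ### The part of a comodule belonging to a point -/

section Part

variable (y : Points Y)

/-- The direct summand of a `Y`-supermodule that belongs to a point of `Y`. -/
abbrev partSubmodule : Submodule k M.carrier :=
  LinearMap.ker (M.act (Fn.idem {y}) - LinearMap.id)

variable {M y} in
theorem mem_part {m : M.carrier} : m ∈ M.partSubmodule y ↔ M.act (Fn.idem {y}) m = m := by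
  rw [LinearMap.mem_ker, LinearMap.sub_apply, sub_eq_zero]
  rfl

/-- The projection onto the direct summand belonging to a point. -/
def toPart : M.carrier →ₗ[k] M.partSubmodule y :=
  (M.act (Fn.idem {y})).codRestrict _ fun m => mem_part.2 (M.act_idem_idem _ m)

theorem toPart_val (m : M.partSubmodule y) : M.toPart y m.1 = m := Subtype.ext (mem_part.1 m.2)

theorem subtype_comp_toPart :
    (M.partSubmodule y).subtype ∘ₗ M.toPart y = M.act (Fn.idem {y}) := rfl

/-- The coaction on the direct summand belonging to a point. -/
def partCoact :
    M.partSubmodule y →ₗ[k] M.partSubmodule y ⊗[k] OStar (component Y y).toFunctor :=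
  TensorProduct.map (M.toPart y) (componentRetraction y) ∘ₗ M.coact ∘ₗ (M.partSubmodule y).subtype

theorem componentInclusion_comp_componentRetraction :
    (componentInclusion y).toLinearMap ∘ₗ componentRetraction y
      = rightMul (Fn.toDual (Fn.idem {y})) :=
  LinearMap.ext (componentInclusion_componentRetraction y)

/-- If `e_y m = m`, coassociativity shows that `ρ(m)` is fixed by `e_y` on the coalgebra factor and,
since `e_y` is central, also on the comodule factor. So `ρ(m)` already lies in `M_y ⊗ O_*(Y_y)`. -/
theorem part_naturality :
    M.coact ∘ₗ (M.partSubmodule y).subtype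
      = TensorProduct.map (M.partSubmodule y).subtype (componentInclusion y).toLinearMap ∘ₗ
        M.partCoact y := by
  refine LinearMap.ext fun m => ?_
  have hm := mem_part.1 m.2
  rw [partCoact, ← LinearMap.comp_assoc, ← TensorProduct.map_comp, subtype_comp_toPart,
    componentInclusion_comp_componentRetraction, ← LinearMap.rTensor_comp_lTensor]
  simp only [LinearMap.comp_apply, Submodule.subtype_apply]
  rw [← coact_contract M.coassoc]
  change _ = (M.act (Fn.idem {y})).rTensor _ (M.coact (M.act (Fn.idem {y}) m.1))
  rw [hm, act, contract_rTensor_coact M.coassoc, ← Fn.rightMul_idem, ← coact_contract M.coassoc]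
  exact congrArg M.coact hm.symm

theorem part_isInternal :
    DirectSum.IsInternal fun i => (M.grading i).comap (M.partSubmodule y).subtype := by
  obtain ⟨p, hp⟩ := exists_isProjections M.isInternal
  have hc := hp.map_comm hp (α := M.act (Fn.idem {y})) fun i m hm => M.act_idem_mem _ hm
  exact IsProjections.isInternal (p := fun i => (p i).restrict fun m hm => mem_part.2 (by
      rw [← hc, mem_part.1 hm]))
    { mem := fun i m => hp.mem i m.1
      of_mem := fun i m hm => Subtype.ext (hp.of_mem i m.1 hm)
      add := fun m => Subtype.ext (hp.add m.1) }

theorem partCoact_mem {i : ZMod 2} {m : M.partSubmodule y} (hm : m.1 ∈ M.grading i) :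
    M.partCoact y m ∈ tensorGrading (fun i => (M.grading i).comap (M.partSubmodule y).subtype)
      (OStar.grading (component Y y).toFunctor) i := by
  have h : ∀ i, ∀ m ∈ M.grading i,
      M.toPart y m ∈ (M.grading i).comap (M.partSubmodule y).subtype :=
    fun i m hm => M.act_idem_mem {y} hm
  exact map_mem_tensorGrading (G' := fun i => (M.grading i).comap (M.partSubmodule y).subtype)
    h (componentRetraction_mem y) (M.coact_even i m.1 hm)

/-- The direct summand belonging to a point, as a super-comodule over the super-coalgebra of the
irreducible component. -/
def part : Supermodule (component Y y).toFunctor where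
  carrier := M.partSubmodule y
  grading i := (M.grading i).comap (M.partSubmodule y).subtype
  isInternal := M.part_isInternal y
  coact := M.partCoact y
  coassoc := coassoc_of_injective (M.part_naturality y) (Submodule.subtype_injective _)
    (componentInclusion_injective y) M.coassoc
  counit_coact := counit_of_injective (M.part_naturality y) (Submodule.subtype_injective _)
    M.counit_coact
  coact_even _ _ hm := M.partCoact_mem y hm

variable {M} in
/-- The morphism induced on the direct summands belonging to a point. -/
def Hom.part {N : Supermodule Y} (α : M.Hom N) : (M.part y).Hom (N.part y) where
  toLin := α.toLin.restrict fun m hm => mem_part.2 (by rw [← α.map_act, mem_part.1 hm])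
  even i m hm := α.even i m.1 hm
  coact_comp := by
    refine LinearMap.ext fun m => ?_
    have h := LinearMap.congr_fun α.coact_comp m.1
    rw [LinearMap.comp_apply] at h
    change TensorProduct.map (N.toPart y) (componentRetraction y) (N.coact (α.toLin m.1)) =
      LinearMap.rTensor _ _ (TensorProduct.map (M.toPart y) (componentRetraction y) (M.coact m.1))
    rw [h, LinearMap.comp_apply, ← LinearMap.comp_apply, LinearMap.map_comp_rTensor,
      ← LinearMap.comp_apply (LinearMap.rTensor _ _), LinearMap.rTensor_comp_map]
    congr 2
    exact LinearMap.ext fun m => Subtype.ext (α.map_act _ m).symm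

/-- The inclusion of the direct summand belonging to a point. -/
def partVal : (M.part y).carrier →ₗ[k] M.carrier := (M.partSubmodule y).subtype

/-- The projection onto the direct summand belonging to a point. -/
def partProj : M.carrier →ₗ[k] (M.part y).carrier := M.toPart y

theorem partVal_injective : Function.Injective (M.partVal y) := Submodule.subtype_injective _

theorem partVal_comp_partProj : M.partVal y ∘ₗ M.partProj y = M.act (Fn.idem {y}) := rfl

theorem partProj_partVal (m : (M.part y).carrier) : M.partProj y (M.partVal y m) = m :=
  M.toPart_val y m

theorem partVal_naturality :
    M.coact ∘ₗ M.partVal y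
      = TensorProduct.map (M.partVal y) (componentInclusion y).toLinearMap ∘ₗ (M.part y).coact :=
  M.part_naturality y

variable {M} in
theorem Hom.comp_partVal {N : Supermodule Y} (α : M.Hom N) :
    α.toLin ∘ₗ M.partVal y = N.partVal y ∘ₗ (α.part y).toLin := rfl

variable {M} in
theorem Hom.part_comp_partProj {N : Supermodule Y} (α : M.Hom N) :
    (α.part y).toLin ∘ₗ M.partProj y = N.partProj y ∘ₗ α.toLin :=
  LinearMap.ext fun m => Subtype.ext (α.map_act _ m)

end Part

end SuperComodule

/-! ### Flatness and irreducible components -/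

/-- On the cotensor product a linear form on `D` acts equally through `M` and through `C`: this is
the defining equation contracted in its `D` factor. -/
theorem rTensor_contract_of_mem_cotensor {C D : Type w} [AddCommGroup C] [Module k C]
    [Coalgebra k C] [AddCommGroup D] [Module k D] [Coalgebra k D] {𝒟 : ZMod 2 → Submodule k D}
    {φ : C →ₗc[k] D} {M : SuperComodule 𝒟} {z : M.carrier ⊗[k] C} (hz : z ∈ cotensor φ M)
    (f : Module.Dual k D) :
    (contract M.carrier f ∘ₗ M.coact).rTensor C z
      = (leftMul (f ∘ₗ φ.toLinearMap)).lTensor M.carrier z := by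
  rw [LinearMap.rTensor_comp_apply, ← lTensor_contractLeft_assoc, mem_cotensor.1 hz,
    ← LinearMap.lTensor_comp_apply]
  congr 2
  refine LinearMap.ext fun c => ?_
  exact contractLeft_map f LinearMap.id φ.toLinearMap (Coalgebra.comul (R := k) c)

theorem Fn.rightMul_rightMul {X : SAlgf k ⥤ Type u} (v w : Fn X) :
    rightMul (Fn.toDual v) ∘ₗ rightMul (Fn.toDual w) = rightMul (Fn.toDual (w * v)) := by
  refine OStar.hom_ext fun a => LinearMap.ext fun g => ?_
  simp only [LinearMap.comp_apply, Fn.rightMul_of]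
  congr 1
  ext x
  exact congrArg g (mul_assoc _ _ _).symm

theorem exists_sum_lTensor_rightMul {X : SAlgf k ⥤ Type u} {M : Type*} [AddCommGroup M]
    [Module k M] (t : M ⊗[k] OStar X) : ∃ F : Finset (Points X), ∀ F', F ⊆ F' →
      ∑ x ∈ F', (rightMul (Fn.toDual (Fn.idem {x}))).lTensor M t = t := by
  classical
  induction t using TensorProduct.induction_on with
  | zero => exact ⟨∅, fun F' _ => by simp⟩
  | add c d hc hd =>
    obtain ⟨F, hF⟩ := hc
    obtain ⟨G, hG⟩ := hd
    refine ⟨F ∪ G, fun F' h => ?_⟩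
    simp only [map_add, Finset.sum_add_distrib]
    rw [hF _ (Finset.union_subset_left h), hG _ (Finset.union_subset_right h)]
  | tmul m c =>
    obtain ⟨F, hF⟩ := Fn.exists_sum_rightMul c
    refine ⟨F, fun F' h => ?_⟩
    simp only [LinearMap.lTensor_tmul]
    rw [← TensorProduct.tmul_sum, hF F' h]

variable {X Y : SAlgf k ⥤ Type u} {f : X ⟶ Y}

theorem componentRetraction_comp_componentInclusion (x : Points X) :
    componentRetraction x ∘ₗ (componentInclusion x).toLinearMap = LinearMap.id :=
  LinearMap.ext (componentRetraction_componentInclusion x)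

/-- A comodule over the component of `Y` is a comodule over `Y` on the same space, so exactness of
the sequence is unchanged by push-forward, and flatness of `f` provides a lift. -/
theorem IsFlat.isFlatAt (hf : IsFlat f) (x : Points X) : IsFlatAt f x := by
  intro L M N α β h
  refine cotensorMap_exact (fun l => (h _).2 ⟨l, rfl⟩) fun z hz e => ?_
  have hc := componentInclusion_map x f
  generalize hj' : componentInclusion (Points.map f x) = j at hc
  have hj : ∀ i, ∀ c ∈ OStar.grading (component Y (Points.map f x)).toFunctor i,
      j c ∈ OStar.grading Y i := hj' ▸ OStar.map_mem (component Y (Points.map f x)).ι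
  have hji : Function.Injective j := hj' ▸ componentInclusion_injective (Points.map f x)
  have hz' := map_mem_cotensor hc (M.toPush_naturality j hj) hz
  have e' : (β.push j hj).toLin.rTensor (OStar X)
      (TensorProduct.map (M.toPush j hj) (componentInclusion x).toLinearMap z) = 0 := by
    rw [← LinearMap.comp_apply, LinearMap.rTensor_comp_map, β.push_comp_toPush,
      ← LinearMap.map_comp_rTensor, LinearMap.comp_apply, e, map_zero]
  obtain ⟨w, hw, hwz⟩ := exists_of_cotensorMap_exact
    (hf _ _ _ (α.push j hj) (β.push j hj) h) hz' e'
  -- The lift `w` may have components at other points of `X`; the retraction keeps the one at `x`.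
  refine ⟨TensorProduct.map (L.ofPush j hj) (componentRetraction x) w, ?_, ?_⟩
  · refine mem_cotensor_of_map_mem hc (L.toPush_naturality j hj) (L.toPush_injective j hj)
      (componentInclusion_injective x) hji ?_
    rw [TensorProduct.map_map, SuperComodule.toPush_comp_ofPush,
      SuperComodule.componentInclusion_comp_componentRetraction]
    exact lTensor_rightMul_mem_cotensor _ hw
  · rw [← LinearMap.comp_apply, LinearMap.rTensor_comp_map, α.comp_ofPush,
      ← LinearMap.map_comp_rTensor, LinearMap.comp_apply, hwz, TensorProduct.map_map,
      SuperComodule.ofPush_comp_toPush, componentRetraction_comp_componentInclusion,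
      TensorProduct.map_id, LinearMap.id_apply]

/-- The component at `x` of an element of `M □ O_*(X)` comes from `M_y ⊗ O_*(X_x)`, `y = f(x)`. -/
theorem map_partVal_map_partProj {M : Supermodule Y} {z : M.carrier ⊗[k] OStar X}
    (hz : z ∈ cotensor (OStar.map f) M) (x : Points X) :
    TensorProduct.map (M.partVal (Points.map f x)) (componentInclusion x).toLinearMap
        (TensorProduct.map (M.partProj (Points.map f x)) (componentRetraction x) z)
      = (rightMul (Fn.toDual (Fn.idem {x}))).lTensor M.carrier z := by
  -- The cotensor condition trades `e_y` on `M` for the idempotent of the fibre over `y` on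
  -- `O_*(X)`. The latter is absorbed by `e_x`, because `x` lies in that fibre.
  rw [TensorProduct.map_map, M.partVal_comp_partProj,
    SuperComodule.componentInclusion_comp_componentRetraction, ← LinearMap.lTensor_comp_rTensor,
    LinearMap.comp_apply, SuperComodule.act, rTensor_contract_of_mem_cotensor hz,
    Fn.toDual_comp_map, Fn.comap_idem, ← Fn.rightMul_idem, ← LinearMap.lTensor_comp_apply,
    Fn.rightMul_rightMul, Fn.idem_mul]
  congr 5
  ext x'
  simp only [Set.mem_inter_iff, Set.mem_preimage, Set.mem_singleton_iff, and_iff_right_iff_imp]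
  rintro rfl
  rfl

theorem SuperComodule.Hom.part_exact {L M N : Supermodule Y} {α : L.Hom M} {β : M.Hom N}
    (h : Function.Exact α.toLin β.toLin) (y : Points Y) :
    Function.Exact (α.part y).toLin (β.part y).toLin := by
  intro m
  constructor
  · intro hm
    obtain ⟨l, hl⟩ := (h (M.partVal y m)).1 (congrArg (N.partVal y) hm)
    refine ⟨L.partProj y l, ?_⟩
    rw [← LinearMap.comp_apply, α.part_comp_partProj, LinearMap.comp_apply, hl, M.partProj_partVal]
  · rintro ⟨l, rfl⟩
    exact N.partVal_injective y ((h _).2 ⟨L.partVal y l, rfl⟩)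

/-- An element of the kernel is the finite sum of its components. Each lives over a single
irreducible component of `X`, where flatness at the point lifts it, and the lifts are added up. -/
theorem isFlat_of_isFlatAt (hf : ∀ x, IsFlatAt f x) : IsFlat f := by
  intro L M N α β h
  refine cotensorMap_exact (fun l => (h _).2 ⟨l, rfl⟩) fun z hz e => ?_
  change z ∈ (cotensor (OStar.map f) L).map (α.toLin.rTensor (OStar X))
  obtain ⟨F, hF⟩ := exists_sum_lTensor_rightMul z
  rw [← hF F subset_rfl]
  refine sum_mem fun x _ => ?_
  rw [← map_partVal_map_partProj hz]
  have hz' : TensorProduct.map (M.partProj (Points.map f x)) (componentRetraction x) z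
      ∈ cotensor (OStar.map (componentMap f x)) (M.part (Points.map f x)) := by
    refine mem_cotensor_of_map_mem (componentInclusion_map x f) (M.partVal_naturality _)
      (M.partVal_injective _) (componentInclusion_injective x) (componentInclusion_injective _) ?_
    rw [map_partVal_map_partProj hz]
    exact lTensor_rightMul_mem_cotensor _ hz
  have e' : (β.part (Points.map f x)).toLin.rTensor _
      (TensorProduct.map (M.partProj (Points.map f x)) (componentRetraction x) z) = 0 := by
    rw [← LinearMap.comp_apply, LinearMap.rTensor_comp_map, β.part_comp_partProj,
      ← LinearMap.map_comp_rTensor, LinearMap.comp_apply, e, map_zero]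
  obtain ⟨w, hw, hwz⟩ := exists_of_cotensorMap_exact
    (hf x _ _ _ (α.part (Points.map f x)) (β.part (Points.map f x))
      (SuperComodule.Hom.part_exact h _)) hz' e'
  refine ⟨TensorProduct.map (L.partVal (Points.map f x)) (componentInclusion x).toLinearMap w,
    map_mem_cotensor (componentInclusion_map x f) (L.partVal_naturality _) hw, ?_⟩
  rw [← hwz, ← LinearMap.comp_apply, LinearMap.rTensor_comp_map, α.comp_partVal,
    ← LinearMap.map_comp_rTensor, LinearMap.comp_apply]

/-! ### Simple comodules -/

namespace SuperComodule

variable {Y : SAlgf k ⥤ Type u} {M : Supermodule Y}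

variable (M) in
/-- A subspace that is stable under the action of the functions on `Y`. -/
def IsStable (U : Submodule k M.carrier) : Prop := ∀ (v : Fn Y), ∀ m ∈ U, M.act v m ∈ U

variable (M) in
/-- A minimal nonzero stable subspace. -/
structure IsMinimalStable (S : Submodule k M.carrier) : Prop where
  stable : M.IsStable S
  ne_bot : S ≠ ⊥
  eq_or_eq : ∀ S' ≤ S, M.IsStable S' → S' = ⊥ ∨ S' = S

theorem exists_finite_contract {V D : Type*} [AddCommGroup V] [Module k V] [AddCommGroup D]
    [Module k D] (t : V ⊗[k] D) :
    ∃ W : Submodule k V, FiniteDimensional k W ∧ ∀ f, contract V f t ∈ W := by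
  induction t using TensorProduct.induction_on with
  | zero => exact ⟨⊥, inferInstance, fun f => by simp⟩
  | tmul m d =>
    exact ⟨k ∙ m, inferInstance, fun f => by
      rw [contract_tmul]; exact Submodule.smul_mem _ _ (Submodule.mem_span_singleton_self m)⟩
  | add t t' h h' =>
    obtain ⟨W, _, hW⟩ := h
    obtain ⟨W', _, hW'⟩ := h'
    exact ⟨W ⊔ W', inferInstance, fun f => by
      rw [map_add]; exact Submodule.add_mem_sup (hW f) (hW' f)⟩

variable (M) in
/-- The orbit of an element. -/
def orbit (m : M.carrier) : Submodule k M.carrier :=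
  LinearMap.range ({ toFun := fun v => M.act v m
                     map_add' := fun v w => M.act_add v w m
                     map_smul' := fun c v => M.act_smul c v m } : Fn Y →ₗ[k] M.carrier)

theorem orbit_isStable (m : M.carrier) : M.IsStable (M.orbit m) := by
  rintro v _ ⟨w, rfl⟩
  exact ⟨w * v, (M.act_act v w m).symm⟩

/-- The orbit lies in the span of the finitely many first tensor factors in an expression for the
coaction of `m`. -/
theorem orbit_finite (m : M.carrier) : FiniteDimensional k (M.orbit m) := by
  obtain ⟨W, _, hW⟩ := exists_finite_contract (M.coact m)
  refine Submodule.finiteDimensional_of_le (S₂ := W) ?_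
  rintro _ ⟨v, rfl⟩
  exact hW _

theorem exists_isMinimalStable_of_finite (n : ℕ) : ∀ (U : Submodule k M.carrier),
    FiniteDimensional k U → Module.finrank k U = n → M.IsStable U → U ≠ ⊥ →
      ∃ S ≤ U, M.IsMinimalStable S := by
  induction n using Nat.strong_induction_on with
  | _ n ih =>
    intro U _ hn hU hU'
    by_cases h : ∃ S' ≤ U, M.IsStable S' ∧ S' ≠ ⊥ ∧ S' ≠ U
    · obtain ⟨S', hle, hS, hS', hne⟩ := h
      have hlt : Module.finrank k S' < Module.finrank k U :=
        Submodule.finrank_lt_finrank_of_lt (lt_of_le_of_ne hle hne)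
      obtain ⟨S, hSle, hSmin⟩ :=
        ih _ (hn ▸ hlt) S' (Submodule.finiteDimensional_of_le hle) rfl hS hS'
      exact ⟨S, hSle.trans hle, hSmin⟩
    · refine ⟨U, le_rfl, hU, hU', fun S' hle hS => ?_⟩
      by_contra! hc
      exact h ⟨S', hle, hS, hc.1, hc.2⟩

theorem IsStable.exists_isMinimalStable {U : Submodule k M.carrier} (hU : M.IsStable U)
    (hne : U ≠ ⊥) : ∃ S ≤ U, M.IsMinimalStable S := by
  obtain ⟨m, hm, hm'⟩ := Submodule.exists_mem_ne_zero_of_ne_bot hne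
  have hmem : m ∈ M.orbit m := ⟨1, M.act_one m⟩
  obtain ⟨S, hS, hS'⟩ := exists_isMinimalStable_of_finite _ (M.orbit m) (orbit_finite m) rfl
    (orbit_isStable m) (fun h => hm' (by rwa [h, Submodule.mem_bot] at hmem))
  refine ⟨S, hS.trans ?_, hS'⟩
  rintro _ ⟨v, rfl⟩
  exact hU v m hm

namespace IsMinimalStable

variable {S : Submodule k M.carrier}

/-- Moving an odd `v` past a function only changes the sign of the odd part of that function, so `v
S` is stable. It is `0` or `S`, and in the latter case `v² = 0` gives `v S = 0` again. -/
theorem act_odd (hS : M.IsMinimalStable S) {v : Fn Y} (hv : ∀ a, v.1 a ∈ a.alg.grading 1)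
    {s : M.carrier} (hs : s ∈ S) : M.act v s = 0 := by
  have hcomm : ∀ w : Fn Y, v * w = (Fn.pr 0 w - Fn.pr 1 w) * v := fun w =>
    Fn.eq_of_apply fun a => by
      change v.1 a * w.1 a = (a.alg.pr 0 (w.1 a) - a.alg.pr 1 (w.1 a)) * v.1 a
      conv_lhs => rw [← a.alg.pr_zero_add_pr_one (w.1 a)]
      rw [mul_add, ← a.alg.mul_comm_of_even (a.alg.pr_mem 0 _),
        a.alg.odd_anticomm (hv a) (a.alg.pr_mem 1 _), sub_mul, sub_eq_add_neg]
  have hsq : ∀ m, M.act v (M.act v m) = 0 := fun m => by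
    rw [act_act, show v * v = 0 from Fn.eq_of_apply fun a => a.alg.odd_sq _ (hv a)]
    have := M.act_smul 0 1 m
    rwa [zero_smul, zero_smul] at this
  have hst : M.IsStable (S.map (M.act v)) := by
    rintro w _ ⟨m, hm, rfl⟩
    exact ⟨_, hS.stable (Fn.pr 0 w - Fn.pr 1 w) m hm, by rw [act_act, act_act, hcomm]⟩
  have hle : S.map (M.act v) ≤ S := by
    rintro _ ⟨m, hm, rfl⟩
    exact hS.stable v m hm
  rcases hS.eq_or_eq _ hle hst with h | h
  · exact (Submodule.mem_bot k).1 (h ▸ Submodule.mem_map_of_mem hs)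
  · obtain ⟨m, _, rfl⟩ := h.symm ▸ hs
    exact hsq m

/-- Schur's lemma: even functions are central, so the kernel of `v` on `S` is stable. -/
theorem act_even (hS : M.IsMinimalStable S) {v : Fn Y} (hv : ∀ a, v.1 a ∈ a.alg.grading 0) :
    (∀ s ∈ S, M.act v s = 0) ∨ ∀ s ∈ S, M.act v s = 0 → s = 0 := by
  have hst : M.IsStable (S ⊓ LinearMap.ker (M.act v)) := by
    rintro w m ⟨hm, hm'⟩
    refine ⟨hS.stable w m hm, ?_⟩
    have hcomm : w * v = v * w := Fn.eq_of_apply fun a =>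
      (a.alg.mul_comm_of_even (hv a) _).symm
    change M.act v (M.act w m) = 0
    rw [act_act, hcomm, ← act_act, LinearMap.mem_ker.1 hm', map_zero]
  rcases hS.eq_or_eq _ inf_le_left hst with h | h
  · right
    intro s hs hs'
    exact (Submodule.mem_bot k).1 (h ▸ ⟨hs, hs'⟩)
  · left
    intro s hs
    rw [← h] at hs
    exact hs.2

/-- A minimal stable subspace belongs to a point of `Y`. -/
theorem exists_point (hS : M.IsMinimalStable S) :
    ∃ y : Points Y, ∀ s ∈ S, M.act (Fn.idem {y}) s = s := by
  obtain ⟨s, hs, hs'⟩ := Submodule.exists_mem_ne_zero_of_ne_bot hS.ne_bot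
  obtain ⟨F, hF⟩ := exists_sum_lTensor_rightMul (M.coact s)
  have h := congrArg (contract M.carrier (Fn.toDual 1)) (hF F subset_rfl)
  simp only [map_sum, contract_lTensor, Fn.toDual_comp_rightMul, mul_one] at h
  have hne : ∑ y ∈ F, M.act (Fn.idem {y}) s ≠ 0 := by
    change ∑ y ∈ F, M.act (Fn.idem {y}) s = M.act 1 s at h
    rw [h, act_one]
    exact hs'
  obtain ⟨y, _, hy⟩ := Finset.exists_ne_zero_of_sum_ne_zero hne
  refine ⟨y, fun t ht => ?_⟩
  rcases hS.act_even (v := Fn.idem {y}) (fun a => a.alg.idem_mem _) with h | h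
  · exact absurd (h s hs) hy
  -- The idempotent is injective on `S` and kills `e_y t - t`.
  · refine sub_eq_zero.1 (h _ (sub_mem (hS.stable _ t ht) ht) ?_)
    rw [map_sub, act_idem_idem, sub_self]

/-- The nilpotency order may be unbounded over the pairs, but an element of `O_*(Y)` involves only
finitely many of them. Hence the exponent depends on `d`. -/
theorem exists_pow_toDual_eq_zero {v : Fn Y} (hv : ∀ a, IsNilpotent (v.1 a)) (d : OStar Y) :
    ∃ n, ∀ n' ≥ n, Fn.toDual (v ^ n') d = 0 := by
  induction d using OStar.induction with
  | zero => exact ⟨0, fun _ _ => map_zero _⟩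
  | add c d hc hd =>
    obtain ⟨n, hn⟩ := hc
    obtain ⟨m, hm⟩ := hd
    exact ⟨max n m, fun n' h => by
      rw [map_add, hn n' (le_of_max_le_left h), hm n' (le_of_max_le_right h), add_zero]⟩
  | of a g =>
    obtain ⟨n, hn⟩ := hv a
    refine ⟨n, fun n' h => ?_⟩
    rw [Fn.toDual_of]
    change g (v.1 a ^ n') = 0
    rw [pow_eq_zero_of_le h hn, map_zero]

theorem exists_pow_contract_eq_zero {v : Fn Y} (hv : ∀ a, IsNilpotent (v.1 a))
    (t : M.carrier ⊗[k] OStar Y) : ∃ n, ∀ n' ≥ n, contract M.carrier (Fn.toDual (v ^ n')) t = 0 := by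
  induction t using TensorProduct.induction_on with
  | zero => exact ⟨0, fun _ _ => map_zero _⟩
  | add c d hc hd =>
    obtain ⟨n, hn⟩ := hc
    obtain ⟨m, hm⟩ := hd
    exact ⟨max n m, fun n' h => by
      rw [map_add, hn n' (le_of_max_le_left h), hm n' (le_of_max_le_right h), add_zero]⟩
  | tmul m d =>
    obtain ⟨n, hn⟩ := exists_pow_toDual_eq_zero hv d
    exact ⟨n, fun n' h => by rw [contract_tmul, hn n' h, zero_smul]⟩

/-- An even function that vanishes at the point to which a minimal stable subspace belongs
annihilates this subspace. -/
theorem act_of_vanish (hS : M.IsMinimalStable S) {y : Points Y}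
    (hy : ∀ s ∈ S, M.act (Fn.idem {y}) s = s) {v : Fn Y} (hv : ∀ a, v.1 a ∈ a.alg.grading 0)
    (hv' : ∀ (a : Pair Y) (p : SSpec a.alg), Points.mk a.elt p = y → v.1 a ∈ p.1) :
    ∀ s ∈ S, M.act v s = 0 := by
  refine (hS.act_even hv).resolve_right fun hinj => ?_
  -- The product `v e_y` vanishes at `y` because of `v` and elsewhere because of `e_y`. Since it
  -- acts on `S` as `v` does, injectivity of `v` would contradict local nilpotence.
  have hnil : ∀ a, IsNilpotent ((v * Fn.idem {y}).1 a) := fun a => by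
    refine a.alg.isNilpotent_of_forall_mem
      (a.alg.mul_mem_grading (hv a) (a.alg.idem_mem _)) fun p => ?_
    by_cases hp : Points.mk a.elt p = y
    · change v.1 a * (Fn.idem {y}).1 a ∈ p.1
      rw [a.alg.mul_comm_of_even (hv a)]
      exact Ideal.mul_mem_left _ _ (hv' a p hp)
    · exact Ideal.mul_mem_left _ _ ((a.alg.idem_mem_iff _ p).2 hp)
  have key : ∀ n, ∀ s ∈ S, M.act ((v * Fn.idem {y}) ^ n) s = 0 → s = 0 := by
    intro n
    induction n with
    | zero => intro s _ h; rwa [pow_zero, act_one] at h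
    | succ n ih =>
      intro s hs h
      rw [pow_succ', ← act_act, ← act_act, hy _ (hS.stable v s hs)] at h
      exact hinj s hs (ih _ (hS.stable v s hs) h)
  obtain ⟨s, hs, hs'⟩ := Submodule.exists_mem_ne_zero_of_ne_bot hS.ne_bot
  obtain ⟨n, hn⟩ := exists_pow_contract_eq_zero hnil (M.coact s)
  exact hs' (key n s hs (hn n le_rfl))

end IsMinimalStable

end SuperComodule

/-! ### Faithfulness -/

/-- Whether a function vanishes at a point. -/
def Fn.VanishesAt {Y : SAlgf k ⥤ Type u} (v : Fn Y) : Points Y → Prop :=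
  Quot.lift (fun s => v.1 s.1 ∈ s.2.1) (by
    rintro s t ⟨h, e⟩
    rw [e]
    change (SAlgf.Hom.lin h.hom (v.1 s.1) ∈ t.2.1) = _
    rw [Fn.compat])

/-- A homomorphism `ψ : A → L` into a finite extension field has a linear map `L → A` that, modulo
the kernel of `ψ`, is `A`-linear and preserves `1`. -/
theorem exists_section {L A : Type*} [Field L] [Algebra k L] [FiniteDimensional k L] [Ring A]
    [Algebra k A] (ψ : A →ₐ[k] L) :
    ∃ τ : L →ₗ[k] A, ψ (τ 1) = 1 ∧ ∀ l a, ψ (τ (l * ψ a)) = ψ (τ l * a) := by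
  -- The image of `ψ` is a subalgebra of an algebraic extension, hence a field `K`. The map `τ` is a
  -- `K`-linear retraction `L → K` followed by a linear section of `ψ` over `K`.
  let K : IntermediateField k L := ψ.range.toIntermediateField fun x hx =>
    ψ.range.inv_mem_of_algebraic (x := ⟨x, hx⟩) (Algebra.IsAlgebraic.isAlgebraic x)
  let ψ' : A →ₗ[k] K := ψ.toLinearMap.codRestrict K.toSubalgebra.toSubmodule
    fun a => ⟨a, rfl⟩
  have hψ' : LinearMap.range ψ' = ⊤ := by
    rw [LinearMap.range_eq_top]
    rintro ⟨_, a, rfl⟩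
    exact ⟨a, rfl⟩
  obtain ⟨σ, hσ⟩ := ψ'.exists_rightInverse_of_surjective hψ'
  obtain ⟨l, hl⟩ := (Algebra.linearMap K L).exists_leftInverse_of_injective
    (LinearMap.ker_eq_bot.2 (algebraMap K L).injective)
  have hσ' : ∀ c : K, ψ (σ c) = c := fun c => congrArg Subtype.val (LinearMap.congr_fun hσ c)
  refine ⟨σ ∘ₗ l.restrictScalars k, ?_, fun x a => ?_⟩
  · have := LinearMap.congr_fun hl 1
    simp only [LinearMap.comp_apply, Algebra.linearMap_apply, map_one, LinearMap.id_apply] at this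
    rw [LinearMap.comp_apply, LinearMap.restrictScalars_apply, this, hσ']
    rfl
  · simp only [LinearMap.comp_apply, LinearMap.restrictScalars_apply]
    have : x * ψ a = ψ' a • x := mul_comm _ _
    rw [hσ', this, map_smul, map_mul ψ, hσ', mul_comm]
    rfl

variable {X Y : SAlgf k ⥤ Type u} {f : X ⟶ Y}

/-- A linear map `R → M` that is compatible with the action of the functions on `Y` defines an
element of `M □ O_*(X)`, for `a ∈ X(R)`. -/
theorem exists_mem_cotensor {M : Supermodule Y} (U : Submodule k M.carrier) (a : Pair X)
    (ζ : a.alg.carrier →ₗ[k] U)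
    (hζ : ∀ v (w : Fn Y), (ζ (v * w.1 (a.map f)) : M.carrier) = M.act w (ζ v)) :
    ∃ z ∈ cotensor (OStar.map f) M, z ∈ LinearMap.range (U.subtype.rTensor (OStar X)) ∧
      contract M.carrier (Fn.toDual 1) z = ζ 1 := by
  let b := Module.Free.chooseBasis k a.alg.carrier
  -- The tensor corresponding to `ζ` under `Hom(R, U) = U ⊗ R^*`, moved to `U ⊗ O_*(X)`; contracting
  -- it with a function `v` returns `ζ` of the value of `v` at `a`.
  let z := ∑ i, ζ (b i) ⊗ₜ[k] OStar.of a (b.coord i)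
  have hz : ∀ v : Fn X, contract M.carrier (Fn.toDual v) (U.subtype.rTensor (OStar X) z)
      = ζ (v.1 a) := by
    intro v
    rw [contract_rTensor, Submodule.subtype_apply]
    congr 1
    conv_rhs => rw [← b.sum_repr (v.1 a)]
    simp only [z, map_sum, contract_tmul, Fn.toDual_of, map_smul]
    rfl
  refine ⟨U.subtype.rTensor (OStar X) z, ?_, ⟨z, rfl⟩, hz 1⟩
  rw [mem_cotensor]
  refine eq_of_contract₂ fun g h => ?_
  obtain ⟨w, rfl⟩ := Fn.toDual_surjective g
  obtain ⟨v, rfl⟩ := Fn.toDual_surjective h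
  rw [lTensor_contract_assoc, contract_rTensor, hz, ← LinearMap.lTensor_comp_apply,
    contract_lTensor]
  have e : Fn.toDual w ∘ₗ contract (OStar Y) (Fn.toDual v) ∘ₗ leftCoact (OStar.map f)
      = Fn.toDual (v * Fn.comap f w) := by
    rw [← Fn.toDual_comp_rightMul, ← Fn.toDual_comp_map]
    refine LinearMap.ext fun c => ?_
    simp only [LinearMap.comp_apply, leftCoact, contract_rTensor]
    rfl
  rw [e, hz]
  exact (hζ (v.1 a) w).symm

/-- If `f` is surjective, every nonzero stable subspace `U` of a `Y`-supermodule `M` gives rise to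
a nonzero element of `M □ O_*(X)` in `U ⊗ O_*(X)`. -/
theorem IsSurjective.exists_mem_cotensor_ne_zero (hf : IsSurjective f) {M : Supermodule Y}
    {U : Submodule k M.carrier} (hU : M.IsStable U) (hne : U ≠ ⊥) :
    ∃ z ∈ cotensor (OStar.map f) M, z ∈ LinearMap.range (U.subtype.rTensor (OStar X)) ∧
      z ≠ 0 := by
  obtain ⟨S, hSU, hS⟩ := hU.exists_isMinimalStable hne
  obtain ⟨y, hy⟩ := hS.exists_point
  obtain ⟨s, hs, hs'⟩ := Submodule.exists_mem_ne_zero_of_ne_bot hS.ne_bot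
  obtain ⟨⟨a, q⟩, hx⟩ : ∃ s : (Σ a : Pair X, SSpec a.alg), Points.mk (s.1.map f).elt s.2 = y := by
    obtain ⟨x, hx⟩ := hf y
    induction x using Quot.ind with
    | _ s => exact ⟨s, hx⟩
  -- The odd part of `v` kills `s` by minimality. The even part vanishes at `q`, hence at every
  -- representative of `y`, since vanishing depends only on the point of `|Y|`.
  have hkill : ∀ v : Fn Y, v.1 (a.map f) ∈ q.1 → M.act v s = 0 := by
    intro v hv
    rw [← Fn.pr_zero_add_pr_one v, M.act_add, hS.act_odd (v := Fn.pr 1 v) (fun b => b.alg.pr_mem 1 _) hs, add_zero]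
    refine hS.act_of_vanish hy (fun b => b.alg.pr_mem 0 _) (fun b p hp => ?_) s hs
    have h : Fn.VanishesAt (Fn.pr 0 v) (Points.mk (a.map f).elt q) := (q.pr_zero_mem_iff _).2 hv
    rw [hx, ← hp] at h
    exact h
  obtain ⟨L, _, _, _, χ, hχ⟩ := SAlgf.exists_residueField q
  let ψ : Fn Y →ₐ[k] L :=
    χ.comp ((Pi.evalAlgHom k (fun b : Pair Y => b.alg.carrier) (a.map f)).comp (Fn Y).val)
  have hψ : ∀ v w : Fn Y, ψ v = ψ w → M.act v s = M.act w s := by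
    intro v w h
    have h' := hkill (v - w) ((hχ _).1 ((map_sub ψ v w).trans (sub_eq_zero.2 h)))
    have h₂ := M.act_add (v - w) w s
    rwa [sub_add_cancel, h', zero_add] at h₂
  obtain ⟨τ, hτ, hτ'⟩ := exists_section ψ
  -- The action on `s` depends only on `ψ`, so `s` spans a copy of the image of `ψ` in `L`. The map
  -- `ζ` takes the residue class in `L`, retracts it to that image and lets it act on `s`; `τ` makes
  -- this compatible with functions on `Y`.
  let ζ : a.alg.carrier →ₗ[k] U :=
    { toFun := fun v => ⟨M.act (τ (χ v)) s, hSU (hS.stable _ s hs)⟩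
      map_add' := fun v w => Subtype.ext (by
        change M.act (τ (χ (v + w))) s = M.act (τ (χ v)) s + M.act (τ (χ w)) s
        rw [map_add, map_add, M.act_add])
      map_smul' := fun c v => Subtype.ext (by
        change M.act (τ (χ (c • v))) s = c • M.act (τ (χ v)) s
        rw [map_smul, map_smul, M.act_smul]) }
  obtain ⟨z, hz, hz', hz''⟩ := exists_mem_cotensor (f := f) U a ζ (fun v w => by
    change M.act (τ (χ (v * w.1 (a.map f)))) s = M.act w (M.act (τ (χ v)) s)
    rw [map_mul, M.act_act]
    exact hψ _ _ (hτ' (χ v) w))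
  refine ⟨z, hz, hz', fun h => hs' ?_⟩
  rw [h, map_zero] at hz''
  rw [hz'']
  change s = M.act (τ (χ 1)) s
  rw [map_one, hψ (τ 1) 1 (hτ.trans (map_one ψ).symm), M.act_one]

/-! ### Cokernels of super-comodules -/

namespace SuperComodule

section Cokernel

variable {D : Type w} [AddCommGroup D] [Module k D] [Coalgebra k D] {𝒟 : ZMod 2 → Submodule k D}
  {L N : SuperComodule 𝒟} (γ : L.Hom N)

/-- The coaction on a cokernel. -/
def cokernelCoact : (N.carrier ⧸ LinearMap.range γ.toLin) →ₗ[k]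
    (N.carrier ⧸ LinearMap.range γ.toLin) ⊗[k] D :=
  (LinearMap.range γ.toLin).liftQ ((LinearMap.range γ.toLin).mkQ.rTensor D ∘ₗ N.coact) (by
    rintro _ ⟨l, rfl⟩
    rw [LinearMap.mem_ker, ← LinearMap.comp_apply, LinearMap.comp_assoc, γ.coact_comp,
      ← LinearMap.comp_assoc, ← LinearMap.rTensor_comp, LinearMap.range_mkQ_comp]
    simp)

theorem cokernel_naturality :
    cokernelCoact γ ∘ₗ (LinearMap.range γ.toLin).mkQ
      = TensorProduct.map (LinearMap.range γ.toLin).mkQ (CoalgHom.id k D).toLinearMap ∘ₗ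
        N.coact := rfl

theorem cokernel_isInternal :
    DirectSum.IsInternal fun i => (N.grading i).map (LinearMap.range γ.toLin).mkQ := by
  obtain ⟨p, hp⟩ := exists_isProjections N.isInternal
  obtain ⟨p', hp'⟩ := exists_isProjections L.isInternal
  exact IsProjections.isInternal (p := fun i => (LinearMap.range γ.toLin).mapQ _ (p i) (by
      rintro _ ⟨l, rfl⟩
      exact ⟨p' i l, (hp'.map_comm hp γ.even i l).symm⟩))
    { mem := fun i m => by
        obtain ⟨m, rfl⟩ := Submodule.mkQ_surjective _ m
        exact ⟨p i m, hp.mem i m, rfl⟩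
      of_mem := fun i m hm => by
        obtain ⟨m, hm, rfl⟩ := hm
        exact congrArg (LinearMap.range γ.toLin).mkQ (hp.of_mem i m hm)
      add := fun m => by
        obtain ⟨m, rfl⟩ := Submodule.mkQ_surjective _ m
        exact congrArg (LinearMap.range γ.toLin).mkQ (hp.add m) }

theorem cokernelCoact_mem {i : ZMod 2} {m : N.carrier ⧸ LinearMap.range γ.toLin}
    (hm : m ∈ (N.grading i).map (LinearMap.range γ.toLin).mkQ) :
    cokernelCoact γ m ∈ tensorGrading
      (fun i => (N.grading i).map (LinearMap.range γ.toLin).mkQ) 𝒟 i := by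
  obtain ⟨m, hm, rfl⟩ := hm
  exact map_mem_tensorGrading (G' := fun i => (N.grading i).map (LinearMap.range γ.toLin).mkQ)
    (β := LinearMap.id) (fun _ _ h => Submodule.mem_map_of_mem h) (fun _ _ h => h)
    (N.coact_even i m hm)

/-- The cokernel of a morphism of super-comodules. -/
def cokernel : SuperComodule 𝒟 where
  carrier := N.carrier ⧸ LinearMap.range γ.toLin
  grading i := (N.grading i).map (LinearMap.range γ.toLin).mkQ
  isInternal := cokernel_isInternal γ
  coact := cokernelCoact γ
  coassoc := coassoc_of_surjective (cokernel_naturality γ) (Submodule.mkQ_surjective _) N.coassoc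
  counit_coact :=
    counit_of_surjective (cokernel_naturality γ) (Submodule.mkQ_surjective _) N.counit_coact
  coact_even _ _ hm := cokernelCoact_mem γ hm

/-- The projection onto the cokernel. -/
def toCokernel : N.Hom (cokernel γ) where
  toLin := (LinearMap.range γ.toLin).mkQ
  even _ m hm := ⟨m, hm, rfl⟩
  coact_comp := rfl

theorem toCokernel_surjective : Function.Surjective (toCokernel γ).toLin :=
  Submodule.mkQ_surjective _

theorem toCokernel_eq_zero_iff {n : N.carrier} :
    (toCokernel γ).toLin n = 0 ↔ n ∈ LinearMap.range γ.toLin :=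
  Submodule.Quotient.mk_eq_zero _

theorem toCokernel_exact : Function.Exact γ.toLin (toCokernel γ).toLin :=
  fun _ => toCokernel_eq_zero_iff γ

/-- The morphism out of a cokernel defined by a morphism with vanishing composite. -/
def cokernelDesc {P : SuperComodule 𝒟} (δ : N.Hom P) (h : ∀ l, δ.toLin (γ.toLin l) = 0) :
    (cokernel γ).Hom P where
  toLin := (LinearMap.range γ.toLin).liftQ δ.toLin (by rintro _ ⟨l, rfl⟩; exact h l)
  even := by
    rintro i _ ⟨m, hm, rfl⟩
    exact δ.even i m hm
  coact_comp := by
    refine (LinearMap.cancel_right (Submodule.mkQ_surjective (LinearMap.range γ.toLin))).1 ?_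
    change P.coact ∘ₗ δ.toLin = LinearMap.rTensor D _ ∘ₗ
      (LinearMap.range γ.toLin).mkQ.rTensor D ∘ₗ N.coact
    rw [← LinearMap.comp_assoc, ← LinearMap.rTensor_comp, Submodule.liftQ_mkQ, δ.coact_comp]

theorem cokernelDesc_toCokernel {P : SuperComodule 𝒟} (δ : N.Hom P)
    (h : ∀ l, δ.toLin (γ.toLin l) = 0) :
    (cokernelDesc γ δ h).toLin ∘ₗ (toCokernel γ).toLin = δ.toLin := rfl

/-- The composition of morphisms of super-comodules. -/
def Hom.comp {P : SuperComodule 𝒟} (δ : N.Hom P) (γ : L.Hom N) : L.Hom P where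
  toLin := δ.toLin ∘ₗ γ.toLin
  even i m hm := δ.even i _ (γ.even i m hm)
  coact_comp := by
    rw [← LinearMap.comp_assoc, δ.coact_comp, LinearMap.comp_assoc, γ.coact_comp,
      ← LinearMap.comp_assoc, LinearMap.rTensor_comp]

/-- The zero super-comodule. -/
def zero (𝒟 : ZMod 2 → Submodule k D) : SuperComodule 𝒟 where
  carrier := PUnit
  grading _ := ⊥
  isInternal := IsProjections.isInternal (p := fun _ => 0)
    { mem := fun _ _ => rfl
      of_mem := fun _ _ _ => rfl
      add := fun _ => rfl }
  coact := 0
  coassoc := LinearMap.ext fun m => by simp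
  counit_coact := LinearMap.ext fun m => by
    rw [Subsingleton.elim m 0, map_zero, map_zero]
  coact_even _ _ _ := zero_mem _

/-- The zero morphism to the zero super-comodule. -/
def toZero (N : SuperComodule 𝒟) : N.Hom (zero 𝒟) where
  toLin := 0
  even _ _ _ := rfl
  coact_comp := by
    rw [LinearMap.rTensor_zero, LinearMap.zero_comp, LinearMap.comp_zero]

theorem exact_toZero_iff : Function.Exact γ.toLin N.toZero.toLin ↔ Function.Surjective γ.toLin :=
  ⟨fun h n => (h n).1 rfl, fun h n => ⟨fun _ => h n, fun _ => rfl⟩⟩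

end Cokernel

/-- The super-coalgebra `O_*(X)` as a super-comodule over itself. -/
def regular (X : SAlgf k ⥤ Type u) : Supermodule X where
  carrier := OStar X
  grading := OStar.grading X
  isInternal := OStar.isProjections.isInternal
  coact := Coalgebra.comul
  coassoc := Coalgebra.coassoc
  counit_coact := Coalgebra.lTensor_counit_comp_comul
  coact_even _ _ hm := OStar.comul_mem hm

/-- The homomorphism `O_*(f)` as a morphism of super-comodules over `O_*(Y)`. -/
def regularMap {X Y : SAlgf k ⥤ Type u} (f : X ⟶ Y) :
    ((regular X).push (OStar.map f) (OStar.map_mem f)).Hom (regular Y) where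
  toLin := (OStar.map f).toLinearMap
  even := OStar.map_mem f
  coact_comp := by
    change Coalgebra.comul ∘ₗ (OStar.map f).toLinearMap
      = (OStar.map f).toLinearMap.rTensor (OStar Y) ∘ₗ
        (OStar.map f).toLinearMap.lTensor (OStar X) ∘ₗ Coalgebra.comul
    rw [← LinearMap.comp_assoc, LinearMap.rTensor_comp_lTensor, (OStar.map f).map_comp_comul]

end SuperComodule

open SuperComodule

/-! ### Faithful flatness and surjectivity -/

variable {X Y : SAlgf k ⥤ Type u} {f : X ⟶ Y}

theorem IsFaithfullyFlat.isFlat (hf : IsFaithfullyFlat f) : IsFlat f :=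
  fun L M N α β h => (hf L M N α β).1 h

/-- Coassociativity pushed along `O_*(f)`. Under `D □_D C = C` the coproduct becomes a section of
the pullback of `regularMap f`. -/
theorem comul_mem_cotensor (f : X ⟶ Y) (c : OStar X) :
    (Coalgebra.comul (R := k) c : OStar X ⊗[k] OStar X)
      ∈ cotensor (OStar.map f) ((regular X).push (OStar.map f) (OStar.map_mem f)) := by
  refine (mem_cotensor (M := (regular X).push (OStar.map f) (OStar.map_mem f))).2 ?_
  have h := congrArg (((OStar.map f).toLinearMap.rTensor (OStar X)).lTensor (OStar X))
    (LinearMap.congr_fun (Coalgebra.coassoc (R := k) (A := OStar X)) c)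
  simp only [LinearMap.comp_apply, ← LinearMap.lTensor_comp_apply] at h
  refine Eq.trans ?_ h
  change TensorProduct.assoc k _ _ _ (((OStar.map f).toLinearMap.lTensor (OStar X) ∘ₗ
    Coalgebra.comul).rTensor (OStar X) (Coalgebra.comul c)) = _
  rw [LinearMap.rTensor_comp_apply]
  have : (TensorProduct.assoc k (OStar X) (OStar Y) (OStar X)).toLinearMap ∘ₗ
      ((OStar.map f).toLinearMap.lTensor (OStar X)).rTensor (OStar X)
      = ((OStar.map f).toLinearMap.rTensor (OStar X)).lTensor (OStar X) ∘ₗ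
        (TensorProduct.assoc k (OStar X) (OStar X) (OStar X)).toLinearMap := by
    ext m d c
    rfl
  exact LinearMap.congr_fun this _

/-- The isomorphism `D □_D C = C`: every element of the left hand side comes from `C`. -/
theorem exists_of_mem_cotensor_regular {z : OStar Y ⊗[k] OStar X}
    (hz : z ∈ cotensor (OStar.map f) (regular Y)) :
    ∃ c : OStar X, (OStar.map f).toLinearMap.rTensor (OStar X) (Coalgebra.comul (R := k) c) = z := by
  have hz' := mem_cotensor.1 hz
  -- The inverse of `C → D □_D C` applies the counit to the first factor; the identity follows by
  -- applying the counit to the first factor of the cotensor condition.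
  refine ⟨contractLeft _ Coalgebra.counit z, ?_⟩
  have e₁ : contractLeft (OStar Y ⊗[k] OStar X) Coalgebra.counit
      ((leftCoact (OStar.map f)).lTensor (OStar Y) z)
        = leftCoact (OStar.map f) (contractLeft _ Coalgebra.counit z) :=
    contractLeft_map Coalgebra.counit (leftCoact (OStar.map f)) LinearMap.id z
  have e₂ : contractLeft (OStar Y ⊗[k] OStar X) Coalgebra.counit
      (TensorProduct.assoc k (OStar Y) (OStar Y) (OStar X)
        ((Coalgebra.comul (R := k) (A := OStar Y)).rTensor (OStar X) z)) = z := by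
    have h₁ : contractLeft (OStar Y ⊗[k] OStar X) (Coalgebra.counit (R := k) (A := OStar Y)) ∘ₗ
        (TensorProduct.assoc k (OStar Y) (OStar Y) (OStar X)).toLinearMap
        = (contractLeft (OStar Y) Coalgebra.counit).rTensor (OStar X) := by
      ext d d' c
      simp [TensorProduct.smul_tmul']
    have h₂ : contractLeft (OStar Y) (Coalgebra.counit (R := k) (A := OStar Y)) ∘ₗ Coalgebra.comul
        = LinearMap.id := by
      rw [contractLeft, LinearMap.comp_assoc, Coalgebra.rTensor_counit_comp_comul]
      ext d
      simp
    refine (LinearMap.congr_fun h₁ _).trans ?_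
    rw [← LinearMap.rTensor_comp_apply, h₂, LinearMap.rTensor_id, LinearMap.id_apply]
  exact e₁.symm.trans ((congrArg _ hz'.symm).trans e₂)

/-- The pullback of `O_*(f)`, seen as a map of `D`-comodules, is surjective because the coproduct
splits it. Surjectivity is exactness with the zero comodule as last term, so faithful exactness
reflects it. -/
theorem IsFaithfullyFlat.isStrictlySurjective (hf : IsFaithfullyFlat f) :
    IsStrictlySurjective f := by
  refine (exact_toZero_iff (regularMap f)).1 ((hf _ _ _ (regularMap f) (regular Y).toZero).2 ?_)
  refine cotensorMap_exact (fun _ => rfl) fun z hz _ => ?_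
  obtain ⟨c, hc⟩ := exists_of_mem_cotensor_regular hz
  exact ⟨_, comul_mem_cotensor f c, hc⟩

/-- For `y` outside the image, `e_y` pulls back to the idempotent of the empty set. So it is zero as
a linear form on the image of `O_*(f)`, which is everything, while at a pair representing `y` it is
not zero. -/
theorem IsStrictlySurjective.isSurjective (hf : IsStrictlySurjective f) : IsSurjective f := by
  intro y
  by_contra hy
  have h₀ : Fn.comap f (Fn.idem {y}) = 0 := by
    rw [Fn.comap_idem, show Points.map f ⁻¹' {y} = ∅ from
      Set.eq_empty_of_forall_notMem fun x hx => hy ⟨x, hx⟩]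
    exact Fn.eq_of_apply fun a => a.alg.idem_empty
  have h₁ : Fn.toDual (Fn.idem {y}) ∘ₗ (OStar.map f).toLinearMap = 0 := by
    rw [Fn.toDual_comp_map, h₀, map_zero]
  have h₂ : ∀ d, Fn.toDual (Fn.idem {y}) d = 0 := fun d => by
    obtain ⟨c, rfl⟩ := hf d
    exact LinearMap.congr_fun h₁ c
  induction y using Quot.ind with
  | _ s =>
    obtain ⟨b, p⟩ := s
    have h₃ : (Fn.idem {Points.mk b.elt p}).1 b = 0 :=
      (Module.forall_dual_apply_eq_zero_iff k _).1 fun g => by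
        rw [← Fn.toDual_of]
        exact h₂ _
    refine (b.alg.idem_mem_iff {q | Points.mk b.elt q ∈ ({Points.mk b.elt p} : Set (Points Y))} p).1
      ?_ rfl
    change (Fn.idem {Points.mk b.elt p}).1 b ∈ p.1
    rw [h₃]
    exact zero_mem _

theorem SuperComodule.Hom.range_isStable {L N : Supermodule Y} (γ : L.Hom N) :
    N.IsStable (LinearMap.range γ.toLin) := by
  rintro v _ ⟨l, rfl⟩
  exact ⟨L.act v l, γ.map_act v l⟩

theorem SuperComodule.Hom.ker_isStable {L N : Supermodule Y} (γ : L.Hom N) :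
    L.IsStable (LinearMap.ker γ.toLin) := by
  intro v m hm
  rw [LinearMap.mem_ker, γ.map_act, LinearMap.mem_ker.1 hm, map_zero]

theorem rTensor_eq_zero_of_mem_range {V W C : Type*} [AddCommGroup V] [Module k V]
    [AddCommGroup W] [Module k W] [AddCommGroup C] [Module k C] {U : Submodule k V}
    {q : V →ₗ[k] W} (hq : ∀ m ∈ U, q m = 0) {z : V ⊗[k] C}
    (hz : z ∈ LinearMap.range (U.subtype.rTensor C)) : q.rTensor C z = 0 := by
  obtain ⟨z, rfl⟩ := hz
  rw [← LinearMap.rTensor_comp_apply, show q ∘ₗ U.subtype = 0 from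
    LinearMap.ext fun m => hq m.1 m.2, LinearMap.rTensor_zero, LinearMap.zero_apply]

/-- Both halves of exactness are read off from nonzero stable subspaces: the image of `β ∘ α`, and
the kernel of the map that `β` induces on the cokernel of `α`. -/
theorem IsFlat.isFaithfullyFlat (hf : IsFlat f) (hs : IsSurjective f) : IsFaithfullyFlat f := by
  refine fun L M N α β => ⟨hf L M N α β, fun h => ?_⟩
  have h₀ : ∀ l, β.toLin (α.toLin l) = 0 := by
    by_contra! hne
    obtain ⟨l, hl⟩ := hne
    obtain ⟨z, hz, hz', hz''⟩ := hs.exists_mem_cotensor_ne_zero (β.comp α).range_isStable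
      (fun h => hl ((Submodule.mem_bot k).1 (h ▸ ⟨l, rfl⟩)))
    -- By flatness, `z` comes from an element `w` of the pullback of `L`; but the pulled-back maps
    -- compose to zero, so `z` is zero.
    obtain ⟨w, hw, rfl⟩ := exists_of_cotensorMap_exact
      (hf _ _ _ _ _ (toCokernel_exact (β.comp α))) hz
      (rTensor_eq_zero_of_mem_range (fun m hm => (toCokernel_eq_zero_iff _).2 hm) hz')
    refine hz'' ?_
    have := (h (pullbackMap f α ⟨w, hw⟩)).2 ⟨_, rfl⟩
    refine Eq.trans ?_ (congrArg Subtype.val this)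
    exact LinearMap.rTensor_comp_apply _ _ _ _
  intro m
  refine ⟨fun hm => ?_, ?_⟩
  · by_contra hmem
    let β' := cokernelDesc α β h₀
    obtain ⟨z, hz, hz', hz''⟩ := hs.exists_mem_cotensor_ne_zero β'.ker_isStable
      (fun h => hmem ((toCokernel_eq_zero_iff α).1 ((Submodule.mem_bot k).1
        (h ▸ (show (toCokernel α).toLin m ∈ LinearMap.ker β'.toLin from hm)))))
    -- Flatness preserves the surjection onto the cokernel, so `z` lifts to some `w` over `M`. Then
    -- `β` kills `w`, the hypothesis writes `w` as an image under `α`, and this image dies in the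
    -- cokernel.
    obtain ⟨w, hw, rfl⟩ := exists_of_cotensorMap_exact
      (hf _ _ _ _ _ ((exact_toZero_iff _).2 (toCokernel_surjective α))) hz
      (by rw [show (toZero (cokernel α)).toLin = 0 from rfl, LinearMap.rTensor_zero]; rfl)
    have h₁ : β.toLin.rTensor (OStar X) w = 0 := by
      rw [← cokernelDesc_toCokernel α β h₀, LinearMap.rTensor_comp_apply]
      exact rTensor_eq_zero_of_mem_range (fun m hm => hm) hz'
    obtain ⟨v, hv, rfl⟩ := exists_of_cotensorMap_exact h hw h₁
    refine hz'' ?_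
    rw [← LinearMap.rTensor_comp_apply, show (toCokernel α).toLin ∘ₗ α.toLin = 0 from
      LinearMap.ext fun l => (toCokernel_eq_zero_iff α).2 ⟨l, rfl⟩, LinearMap.rTensor_zero,
      LinearMap.zero_apply]
  · rintro ⟨l, rfl⟩
    exact h₀ l

end FormalSuper

end

/-! ### Conclusion: the cycle (a) ⇒ (c) ⇒ (b) ⇒ (a). -/

open CategoryTheory FormalSuper in
theorem mainTheorem6 {k : Type u} [Field k] (hk : ringChar k ≠ 2) (X Y : SAlgf k ⥤ Type u)
    (hX : IsFormalSuperscheme X) (hY : IsFormalSuperscheme Y) (f : X ⟶ Y) :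
    (IsFlat f ↔ ∀ x : Points X, IsFlatAt f x) ∧
      (IsFaithfullyFlat f ↔ IsFlat f ∧ IsSurjective f) ∧
      (IsFaithfullyFlat f ↔ IsFlat f ∧ IsStrictlySurjective f) := by
  have h₁ : IsFaithfullyFlat f → IsFlat f ∧ IsStrictlySurjective f :=
    fun h => ⟨h.isFlat, h.isStrictlySurjective⟩
  have h₂ : IsFlat f ∧ IsStrictlySurjective f → IsFlat f ∧ IsSurjective f :=
    fun h => ⟨h.1, h.2.isSurjective⟩
  have h₃ : IsFlat f ∧ IsSurjective f → IsFaithfullyFlat f := fun h => h.1.isFaithfullyFlat h.2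
  exact ⟨⟨fun h x => h.isFlatAt x, isFlat_of_isFlatAt⟩, ⟨h₂ ∘ h₁, h₃⟩, ⟨h₁, h₃ ∘ h₂⟩⟩
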